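/- Let $M\ge 1$, let $h_1,\dots,h_{J_1}\in\mathbb R^M$ be distinct vectors ($J_1\ge 1$) and let $g_1,\dots,g_{J_2}\in\mathbb R^M$ be distinct vectors. Assume that any $M$ or fewer vectors of the set $\{h_1,\dots,h_{J_1}\}\cup\{g_1,\dots,g_{J_2}\}$ are linearly independent. Consider the compound MISO wiretap channel $$y_j(t)=h_j^Tx(t)+v_j(t)\quad(1\le j\le J_1),\qquad z_k(t)=g_k^Tx(t)+w_k(t)\quad(1\le k\le J_2),$$ where $x(t)\in\mathbb R^M$ is the channel input at time $t$ and, at each terminal, the noise is i.i.d. $\mathcal N(0,1)$ over time and independent of the message and of the input. A code of block length $n$ consists of a message $m$, uniformly distributed over a finite set, a stochastic encoder that maps $m$ to a random input sequence $x^n=(x(1),\dots,x(n))$, and a decoder $\hat m_j=\hat m_j(y_j^n)$ for each $j$. A rate $R$ (in bits per channel use) is achievable at power $P$ if there is a sequence of codes, one for each block length $n$, with $2^{n(R+o(1))}$ messages, such that $\frac1n\sum_{t=1}^nE\|x(t)\|^2\le P$ for every $n$, and, as $n\to\infty$, $\Pr(\hat m_j\ne m)\to0$ for every $j$ and $\frac1nI(m;z_k^n)\to0$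 for every $k$. A number $d$ is an achievable secure degrees of freedom if there are rates $R(P)$, achievable at power $P$ for each $P>0$, with $d=\lim_{P\to\infty}R(P)/(\frac12\log_2P)$. The secrecy degrees of freedom is the supremum of all such $d$. Then the secrecy degrees of freedom is at most $$d_U=\begin{cases}1,&\min(J_1,J_2)<M,\\[2pt] 1-\dfrac1{M^2-M+1},&\min(J_1,J_2)\ge M.\end{cases}$$ -/

import Mathlib

open MeasureTheory ProbabilityTheory Filter Topology
open scoped ENNReal

namespace CompoundWiretap

noncomputable section

/-- The mutual information `I(A; B)` (in nats) of a pair `(A, B)` with joint law `μ`: the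
Kullback-Leibler divergence of the joint law from the product of its marginals. -/
def mutualInfo {α β : Type*} [MeasurableSpace α] [MeasurableSpace β] (μ : Measure (α × β)) :
    ℝ≥0∞ :=
  InformationTheory.klDiv μ ((μ.map Prod.fst).prod (μ.map Prod.snd))

/-- A compound wiretap code of block length `n` for a transmitter with `M` antennas and `J₁`
states of the legitimate receiver: a finite nonempty message set, a stochastic encoder which maps
a message to a random sequence of `n` channel input vectors, and one decoder for each state. -/
structure Code (M J₁ n : ℕ) where
  /-- the number of messages -/
  size : ℕ
  size_ne_zero : NeZero size
  /-- the conditional law of the input sequence given the message -/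
  enc : Kernel (Fin size) (Fin n → EuclideanSpace ℝ (Fin M))
  isMarkovKernel_enc : IsMarkovKernel enc
  dec : Fin J₁ → (Fin n → ℝ) → Fin size
  measurable_dec : ∀ j, Measurable (dec j)

attribute [instance] Code.size_ne_zero Code.isMarkovKernel_enc

namespace Code

variable {M J₁ n : ℕ} (c : Code M J₁ n)

/-- The joint law of the uniformly distributed message and of the channel input sequence. -/
def inputLaw : Measure (Fin c.size × (Fin n → EuclideanSpace ℝ (Fin M))) :=
  (PMF.uniformOfFintype (Fin c.size)).toMeasure ⊗ₘ c.enc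

/-- The joint law of the message and of the output sequence `y(t) = aᵀ x(t) + v(t)`, `t < n`, at a
terminal with channel vector `a`; the noise `v(t)` is i.i.d. standard normal and independent of
the message and of the input. -/
def outputLaw (a : EuclideanSpace ℝ (Fin M)) : Measure (Fin c.size × (Fin n → ℝ)) :=
  (c.inputLaw.prod (Measure.pi fun _ : Fin n => gaussianReal 0 1)).map
    fun p => (p.1.1, fun t => inner ℝ a (p.1.2 t) + p.2 t)

/-- The average power constraint `(1/n) ∑ₜ E ‖x(t)‖² ≤ P`. -/
def PowerConstraint (P : ℝ) : Prop :=
  ∑ t, ∫⁻ p, ‖p.2 t‖ₑ ^ 2 ∂c.inputLaw ≤ (n : ℝ≥0∞) * ENNReal.ofReal P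

/-- The probability that the decoder for state `j`, with channel vector `a`, does not return the
transmitted message. -/
def errorProb (a : EuclideanSpace ℝ (Fin M)) (j : Fin J₁) : ℝ≥0∞ :=
  c.outputLaw a {p | c.dec j p.2 ≠ p.1}

/-- The information `I(m; zⁿ)` which an eavesdropper with channel vector `a` obtains about the
message. -/
def leakage (a : EuclideanSpace ℝ (Fin M)) : ℝ≥0∞ :=
  mutualInfo (c.outputLaw a)

end Code

/-- `R` (in bits per channel use) is an achievable secrecy rate at power `P` for the compound
wiretap channel with legitimate channel vectors `h j` and eavesdropper channel vectors `g k`: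
some sequence of codes with `2 ^ (n R)` messages, up to a factor `2 ^ o(n)` (rounding), satisfies
the power constraint and has vanishing error probability for each legitimate state and vanishing
leakage rate for each eavesdropper state. -/
def AchievableRate {M J₁ J₂ : ℕ} (h : Fin J₁ → EuclideanSpace ℝ (Fin M))
    (g : Fin J₂ → EuclideanSpace ℝ (Fin M)) (P R : ℝ) : Prop :=
  ∃ c : (n : ℕ) → Code M J₁ n,
    Tendsto (fun n => Real.logb 2 (c n).size / n) atTop (𝓝 R) ∧
    (∀ n, (c n).PowerConstraint P) ∧
    (∀ j, Tendsto (fun n => (c n).errorProb (h j) j) atTop (𝓝 0)) ∧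
    ∀ k, Tendsto (fun n : ℕ => (c n).leakage (g k) / (n : ℝ≥0∞)) atTop (𝓝 0)

/-- `d` is an achievable secure degrees of freedom: there are achievable rates `R(P)` with
`R(P) / ((1/2) log₂ P) → d` as `P → ∞`. -/
def AchievableDoF {M J₁ J₂ : ℕ} (h : Fin J₁ → EuclideanSpace ℝ (Fin M))
    (g : Fin J₂ → EuclideanSpace ℝ (Fin M)) (d : ℝ) : Prop :=
  ∃ R : ℝ → ℝ, (∀ P, 0 < P → AchievableRate h g P (R P)) ∧
    Tendsto (fun P => R P / (1 / 2 * Real.logb 2 P)) atTop (𝓝 d)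

/-- The secrecy degrees of freedom: the supremum, in the extended reals, of the achievable secure
degrees of freedom. -/
def secrecyDoF {M J₁ J₂ : ℕ} (h : Fin J₁ → EuclideanSpace ℝ (Fin M))
    (g : Fin J₂ → EuclideanSpace ℝ (Fin M)) : EReal :=
  ⨆ d ∈ {d : ℝ | AchievableDoF h g d}, (d : EReal)

end

end CompoundWiretap

/-!
Every terminal sees its signal in Gaussian noise, so that all outputs have positive densities bounded
by `1` and all entropies below are means of negative log-densities. Let `Y` be the outputs at `M`
legitimate states `h j`, let `Z` be the outputs at `M` eavesdropper states `g k`, and give all these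
terminals independent noise. Both families of channel vectors are bases, so `Z` is a linear image of
`Y` up to noise of bounded variance, and conversely. Write `G` for the entropy of `(Y, Z)` given the
message, `n` for the block length and `K` for the logarithm of the number of messages. Up to errors
`O(n) + o(K)`, with `O(n)` independent of the power `P`:

* `G ≤ ∑ⱼ h(yⱼ | m)`, by subadditivity (`Code.PowerConstraint.pairEntropy_le`);
* `h(yⱼ | m) + K ≤ (n / 2) log P`, by Fano's inequality and the power constraint
  (`Code.PowerConstraint.condEntropy_add_le`);
* `G + K ≤ ∑ₖ h(zₖ)`, by Fano's inequality and subadditivity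
  (`Code.PowerConstraint.pairEntropy_add_le`);
* `h(zₖ) = h(zₖ | m) + I(m; zₖ)`, where the leakage is `o(n)`
  (`Code.PowerConstraint.toReal_leakage`);
* `h(zₖ | m) ≤ G`, by monotonicity (`Code.PowerConstraint.condEntropy_le_pairEntropy`).

The last three give `K ≤ (M - 1) G`, the first two `G ≤ M ((n / 2) log P - K)`, and therefore
`(1 + M (M - 1)) K ≤ M (M - 1) (n / 2) log P`, which is the bound for `min J₁ J₂ ≥ M`. The bound `1`
is the second item with `0 ≤ h(yⱼ | m)`.

The first three items are instances of Gibbs' inequality `∫ log q ≤ ∫ log f`, for the true density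
`f` and a suitable density `q`: a product of densities of single outputs, in the first and third
item times the normal density of the error of the linear prediction, in the second and third times
a guess of the conditional law of the message. The last item holds pointwise, as dropping noise
densities increases their product.
-/

namespace CompoundWiretap

/-! ### Products of densities -/

theorem lintegral_ofReal_prod_pi {ι : Type*} [Fintype ι] {α : ι → Type*}
    [∀ i, MeasurableSpace (α i)] (μ : ∀ i, Measure (α i)) [∀ i, SigmaFinite (μ i)]
    (f : ∀ i, α i → ℝ) (hf : ∀ i, Integrable (f i) (μ i)) (h0 : ∀ i x, 0 ≤ f i x) :
    ∫⁻ x, ENNReal.ofReal (∏ i, f i (x i)) ∂Measure.pi μ =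
      ∏ i, ∫⁻ x, ENNReal.ofReal (f i x) ∂μ i := by
  rw [← ofReal_integral_eq_lintegral_ofReal (Integrable.fintype_prod_dep hf)
    (ae_of_all _ fun x => Finset.prod_nonneg fun i _ => h0 i _),
    integral_fintype_prod_eq_prod, ENNReal.ofReal_prod_of_nonneg
      (fun i _ => integral_nonneg (h0 i))]
  exact Finset.prod_congr rfl fun i _ =>
    ofReal_integral_eq_lintegral_ofReal (hf i) (ae_of_all _ (h0 i))

theorem pi_withDensity_ofReal {ι : Type*} [Fintype ι] {α : ι → Type*}
    [∀ i, MeasurableSpace (α i)] (μ : ∀ i, Measure (α i)) [∀ i, SigmaFinite (μ i)]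
    (f : ∀ i, α i → ℝ) (hf : ∀ i, Integrable (f i) (μ i)) (h0 : ∀ i x, 0 ≤ f i x) :
    Measure.pi (fun i => (μ i).withDensity fun x => ENNReal.ofReal (f i x)) =
      (Measure.pi μ).withDensity fun x => ENNReal.ofReal (∏ i, f i (x i)) := by
  refine Measure.pi_eq fun s hs => ?_
  rw [withDensity_apply _ (MeasurableSet.univ_pi hs), Measure.restrict_pi_pi,
    lintegral_ofReal_prod_pi _ f (fun i => (hf i).restrict) h0]
  exact Finset.prod_congr rfl fun i _ => (withDensity_apply _ (hs i)).symm

/-- A strictly positive probability density, with respect to the volume measure, which is bounded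
by `1`. The bound makes the negative log-densities below nonnegative. -/
structure IsNoiseDensity {O : Type*} [MeasureSpace O] (g : O → ℝ) : Prop where
  measurable : Measurable g
  pos : ∀ v, 0 < g v
  le_one : ∀ v, g v ≤ 1
  lintegral_eq_one : ∫⁻ v, ENNReal.ofReal (g v) = 1

namespace IsNoiseDensity

theorem integrable {O : Type*} [MeasureSpace O] {g : O → ℝ} (hg : IsNoiseDensity g) :
    Integrable g := by
  refine ⟨hg.measurable.aestronglyMeasurable, ?_⟩
  rw [hasFiniteIntegral_iff_ofReal (ae_of_all _ fun v => (hg.pos v).le), hg.lintegral_eq_one]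
  exact ENNReal.one_lt_top

theorem pi {ι : Type*} [Fintype ι] {α : ι → Type*} [∀ i, MeasureSpace (α i)]
    [∀ i, SigmaFinite (volume : Measure (α i))] {g : ∀ i, α i → ℝ}
    (hg : ∀ i, IsNoiseDensity (g i)) :
    IsNoiseDensity fun v : ∀ i, α i => ∏ i, g i (v i) where
  measurable := Finset.measurable_prod _ fun i _ =>
    (hg i).measurable.comp (measurable_pi_apply i)
  pos v := Finset.prod_pos fun i _ => (hg i).pos _
  le_one v := Finset.prod_le_one (fun i _ => ((hg i).pos _).le) fun i _ => (hg i).le_one _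
  lintegral_eq_one := by
    rw [volume_pi, lintegral_ofReal_prod_pi _ _ (fun i => (hg i).integrable)
      fun i x => ((hg i).pos x).le]
    exact Finset.prod_eq_one fun i _ => (hg i).lintegral_eq_one

theorem prod {α β : Type*} [MeasureSpace α] [MeasureSpace β]
    [SFinite (volume : Measure β)] {f : α → ℝ} {g : β → ℝ}
    (hf : IsNoiseDensity f) (hg : IsNoiseDensity g) :
    IsNoiseDensity fun v : α × β => f v.1 * g v.2 where
  measurable := (hf.measurable.comp measurable_fst).mul (hg.measurable.comp measurable_snd)
  pos v := mul_pos (hf.pos _) (hg.pos _)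
  le_one v := mul_le_one₀ (hf.le_one _) (hg.pos _).le (hg.le_one _)
  lintegral_eq_one := by
    simp_rw [ENNReal.ofReal_mul (hf.pos _).le]
    rw [Measure.volume_eq_prod, lintegral_prod_mul hf.measurable.ennreal_ofReal.aemeasurable
      hg.measurable.ennreal_ofReal.aemeasurable, hf.lintegral_eq_one, hg.lintegral_eq_one, one_mul]

end IsNoiseDensity

theorem isNoiseDensity_gaussianPDFReal {V : NNReal} (hV : 1 ≤ V) :
    IsNoiseDensity (gaussianPDFReal 0 V) where
  measurable := measurable_gaussianPDFReal 0 V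
  pos v := gaussianPDFReal_pos _ _ _ (one_pos.trans_le hV).ne'
  le_one v := by
    have hV' : (1 : ℝ) ≤ V := hV
    rw [gaussianPDFReal_def]
    refine mul_le_one₀ (inv_le_one_of_one_le₀ ?_) (Real.exp_pos _).le ?_
    · rw [Real.one_le_sqrt]
      nlinarith [Real.pi_gt_three]
    · rw [Real.exp_le_one_iff]
      exact div_nonpos_of_nonpos_of_nonneg (neg_nonpos.2 (sq_nonneg _)) (by positivity)
  lintegral_eq_one := lintegral_gaussianPDFReal_eq_one 0 (one_pos.trans_le hV).ne'

theorem log_gaussianPDFReal {V : NNReal} (hV : V ≠ 0) (x : ℝ) :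
    Real.log (gaussianPDFReal 0 V x) =
      -(1 / 2 * Real.log (2 * Real.pi * V) + x ^ 2 / (2 * V)) := by
  have hV' : (0 : ℝ) < V := NNReal.coe_pos.2 (pos_iff_ne_zero.2 hV)
  have h0 : 0 < √(2 * Real.pi * V) := Real.sqrt_pos.2 (by positivity)
  rw [gaussianPDFReal_def]
  simp only
  rw [Real.log_mul (inv_pos.2 h0).ne' (Real.exp_pos _).ne', Real.log_exp, Real.log_inv,
    Real.log_sqrt (by positivity), sub_zero]
  ring

/-! ### Gibbs' inequality -/

/-- Gibbs' inequality: the mean of the logarithm of a sub-probability density is largest for the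
true density. -/
theorem integral_log_le_of_withDensity {α : Type*} [MeasurableSpace α] {μ ν : Measure α}
    [IsProbabilityMeasure ν] {f q : α → ℝ}
    (hν : ν = μ.withDensity fun x => ENNReal.ofReal (f x))
    (hf : Measurable f) (hq : Measurable q) (hf0 : ∀ x, 0 < f x) (hq0 : ∀ x, 0 < q x)
    (hq1 : ∫⁻ x, ENNReal.ofReal (q x) ∂μ ≤ 1)
    (hfi : Integrable (fun x => Real.log (f x)) ν) (hqi : Integrable (fun x => Real.log (q x)) ν) :
    ∫ x, Real.log (q x) ∂ν ≤ ∫ x, Real.log (f x) ∂ν := by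
  have hlin : ∫⁻ x, ENNReal.ofReal (q x / f x) ∂ν ≤ 1 := by
    have hm : Measurable fun x => ENNReal.ofReal (q x / f x) := (hq.div hf).ennreal_ofReal
    rw [hν, lintegral_withDensity_eq_lintegral_mul _ hf.ennreal_ofReal hm]
    refine le_trans (le_of_eq (lintegral_congr fun x => ?_)) hq1
    rw [Pi.mul_apply, ← ENNReal.ofReal_mul (hf0 x).le, mul_div_cancel₀ _ (hf0 x).ne']
  have hpos : ∀ x, 0 ≤ q x / f x := fun x => (div_pos (hq0 x) (hf0 x)).le
  have hi : Integrable (fun x => q x / f x) ν := by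
    refine ⟨(hq.div hf).aestronglyMeasurable, ?_⟩
    rw [hasFiniteIntegral_iff_ofReal (ae_of_all _ hpos)]
    exact hlin.trans_lt ENNReal.one_lt_top
  have hle : ∫ x, q x / f x ∂ν ≤ 1 := by
    rw [integral_eq_lintegral_of_nonneg_ae (ae_of_all _ hpos) (hq.div hf).aestronglyMeasurable]
    exact ENNReal.toReal_le_of_le_ofReal zero_le_one (by simpa using hlin)
  have key : ∫ x, (Real.log (q x) - Real.log (f x)) ∂ν ≤ ∫ x, (q x / f x - 1) ∂ν := by
    refine integral_mono (hqi.sub hfi) (hi.sub (integrable_const _)) fun x => ?_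
    simp only
    rw [← Real.log_div (hq0 x).ne' (hf0 x).ne']
    exact Real.log_le_sub_one_of_pos (div_pos (hq0 x) (hf0 x))
  rw [integral_sub hqi hfi, integral_sub hi (integrable_const _)] at key
  simp at key
  linarith

/-! ### Additive noise channels -/

theorem lintegral_count_prod {N : ℕ} {O : Type*} [MeasureSpace O]
    [SFinite (volume : Measure O)] {F : Fin N × O → ℝ≥0∞} (hF : Measurable F) :
    ∫⁻ p, F p ∂(Measure.count.prod volume) = ∑ m, ∫⁻ u, F (m, u) := by
  rw [lintegral_prod _ hF.aemeasurable, lintegral_fintype]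
  simp

section Channel

variable {N : ℕ} {X O : Type*} [MeasurableSpace X] [MeasureSpace O] [AddCommGroup O]
  (κ : Kernel (Fin N) X) [IsMarkovKernel κ] (s : X → O) (g : O → ℝ)

/-- The joint law of a uniformly distributed message and of the output `s x + v` of an additive
noise channel, where the input `x` has law `κ m` given the message `m` and `v` has law `ν`. -/
noncomputable def channelLaw [NeZero N] (ν : Measure O) : Measure (Fin N × O) :=
  (((PMF.uniformOfFintype (Fin N)).toMeasure ⊗ₘ κ).prod ν).map fun p => (p.1.1, s p.1.2 + p.2)

/-- The density of the output given the message `m`, for noise with density `g`. -/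
noncomputable def channelDensity (m : Fin N) (u : O) : ℝ :=
  ∫ x, g (u - s x) ∂κ m

/-- The density of the output, for noise with density `g`. -/
noncomputable def meanDensity (u : O) : ℝ :=
  (N : ℝ)⁻¹ * ∑ m, channelDensity κ s g m u

/-- The joint density of the message and the output, with respect to the product of the counting
measure and the volume. -/
noncomputable def jointDensity (p : Fin N × O) : ℝ :=
  (N : ℝ)⁻¹ * channelDensity κ s g p.1 p.2

theorem lintegral_uniform_compProd [NeZero N] {F : Fin N × X → ℝ≥0∞} (hF : Measurable F) :
    ∫⁻ p, F p ∂((PMF.uniformOfFintype (Fin N)).toMeasure ⊗ₘ κ) =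
      ∑ m, ENNReal.ofReal (N : ℝ)⁻¹ * ∫⁻ x, F (m, x) ∂κ m := by
  rw [Measure.lintegral_compProd hF, lintegral_fintype]
  refine Finset.sum_congr rfl fun m _ => ?_
  rw [PMF.toMeasure_apply_singleton _ _ (measurableSet_singleton m), PMF.uniformOfFintype_apply,
    Fintype.card_fin, ENNReal.ofReal_inv_of_pos (by exact_mod_cast NeZero.pos N),
    ENNReal.ofReal_natCast, mul_comm]

variable {κ s g}

section Density

variable [MeasurableSub₂ O] (hs : Measurable s) (hg : IsNoiseDensity g)
include hs hg

theorem integrable_noise_sub (m : Fin N) (u : O) : Integrable (fun x => g (u - s x)) (κ m) :=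
  Integrable.of_bound (hg.measurable.comp (measurable_const.sub hs)).aestronglyMeasurable 1
    (ae_of_all _ fun x => by
      rw [Real.norm_of_nonneg (hg.pos _).le]
      exact hg.le_one _)

theorem channelDensity_pos (m : Fin N) (u : O) : 0 < channelDensity κ s g m u := by
  rw [channelDensity, integral_pos_iff_support_of_nonneg (fun x => (hg.pos _).le)
    (integrable_noise_sub hs hg m u)]
  have : (Function.support fun x => g (u - s x)) = Set.univ :=
    Set.eq_univ_of_forall fun x => (hg.pos _).ne'
  rw [this, measure_univ]
  exact one_pos

theorem channelDensity_le_one (m : Fin N) (u : O) : channelDensity κ s g m u ≤ 1 := by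
  have := integral_mono (integrable_noise_sub (κ := κ) hs hg m u) (integrable_const (1 : ℝ))
    fun x => hg.le_one (u - s x)
  simpa [channelDensity] using this

theorem measurable_channelDensity (m : Fin N) : Measurable (channelDensity κ s g m) := by
  have : Measurable fun p : O × X => g (p.1 - s p.2) :=
    hg.measurable.comp (measurable_fst.sub (hs.comp measurable_snd))
  exact this.stronglyMeasurable.integral_prod_right.measurable

theorem measurable_uncurry_channelDensity :
    Measurable fun p : Fin N × O => channelDensity κ s g p.1 p.2 :=
  measurable_from_prod_countable_right fun m => measurable_channelDensity hs hg m

theorem ofReal_channelDensity (m : Fin N) (u : O) :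
    ENNReal.ofReal (channelDensity κ s g m u) = ∫⁻ x, ENNReal.ofReal (g (u - s x)) ∂κ m :=
  ofReal_integral_eq_lintegral_ofReal (integrable_noise_sub hs hg m u)
    (ae_of_all _ fun _ => (hg.pos _).le)

theorem measurable_jointDensity : Measurable (jointDensity κ s g) :=
  (measurable_uncurry_channelDensity hs hg).const_mul _

theorem jointDensity_pos [NeZero N] (p : Fin N × O) : 0 < jointDensity κ s g p :=
  mul_pos (inv_pos.2 (Nat.cast_pos.2 (NeZero.pos N))) (channelDensity_pos hs hg _ _)

variable [MeasurableAdd₂ O] [SFinite (volume : Measure O)]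
  [(volume : Measure O).IsAddLeftInvariant]

/-- Tonelli's theorem and translation invariance: given the message, `channelDensity` is the density
of the output. -/
theorem lintegral_noise_add (m : Fin N) {F : O → ℝ≥0∞} (hF : Measurable F) :
    ∫⁻ x, (∫⁻ v, F (s x + v) * ENNReal.ofReal (g v)) ∂κ m =
      ∫⁻ u, F u * ENNReal.ofReal (channelDensity κ s g m u) := by
  have hmeas : Measurable fun p : X × O => F p.2 * ENNReal.ofReal (g (p.2 - s p.1)) :=
    (hF.comp measurable_snd).mul
      (hg.measurable.comp (measurable_snd.sub (hs.comp measurable_fst))).ennreal_ofReal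
  calc ∫⁻ x, (∫⁻ v, F (s x + v) * ENNReal.ofReal (g v)) ∂κ m
      = ∫⁻ x, (∫⁻ u, F u * ENNReal.ofReal (g (u - s x))) ∂κ m := by
        refine lintegral_congr fun x => ?_
        rw [← lintegral_add_left_eq_self (fun u => F u * ENNReal.ofReal (g (u - s x))) (s x)]
        simp only [add_sub_cancel_left]
    _ = ∫⁻ u, ∫⁻ x, F u * ENNReal.ofReal (g (u - s x)) ∂κ m := lintegral_lintegral_swap
        hmeas.aemeasurable
    _ = _ := by
        refine lintegral_congr fun u => ?_
        rw [ofReal_channelDensity hs hg, lintegral_const_mul]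
        exact (hg.measurable.comp (measurable_const.sub hs)).ennreal_ofReal

theorem lintegral_channelDensity (m : Fin N) :
    ∫⁻ u, ENNReal.ofReal (channelDensity κ s g m u) = 1 := by
  have := lintegral_noise_add (κ := κ) hs hg m (F := fun _ => 1) measurable_const
  simp only [one_mul, hg.lintegral_eq_one, lintegral_const, measure_univ] at this
  exact this.symm

/-- Given the message, the output density is again a noise density. -/
theorem isNoiseDensity_channelDensity (m : Fin N) :
    IsNoiseDensity (channelDensity κ s g m) where
  measurable := measurable_channelDensity hs hg m
  pos := channelDensity_pos hs hg m
  le_one := channelDensity_le_one hs hg m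
  lintegral_eq_one := lintegral_channelDensity hs hg m

variable [NeZero N]

theorem isNoiseDensity_meanDensity : IsNoiseDensity (meanDensity κ s g) where
  measurable := (Finset.measurable_sum _ fun m _ => measurable_channelDensity hs hg m).const_mul _
  pos u := mul_pos (inv_pos.2 (Nat.cast_pos.2 (NeZero.pos N)))
    (Finset.sum_pos (fun m _ => channelDensity_pos hs hg m u) Finset.univ_nonempty)
  le_one u := by
    have hN : (0 : ℝ) < N := Nat.cast_pos.2 (NeZero.pos N)
    rw [meanDensity, inv_mul_le_one₀ hN]
    refine (Finset.sum_le_sum fun m _ => channelDensity_le_one hs hg m u).trans ?_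
    simp
  lintegral_eq_one := by
    have hN : (0 : ℝ) < N := Nat.cast_pos.2 (NeZero.pos N)
    simp_rw [meanDensity, ENNReal.ofReal_mul (inv_nonneg.2 hN.le),
      ENNReal.ofReal_sum_of_nonneg fun m _ => (channelDensity_pos hs hg m _).le]
    rw [lintegral_const_mul, lintegral_finsetSum]
    · simp_rw [lintegral_channelDensity hs hg]
      rw [ENNReal.ofReal_inv_of_pos hN]
      simp only [Finset.sum_const, Finset.card_univ, Fintype.card_fin, nsmul_eq_mul, mul_one,
        ENNReal.ofReal_natCast]
      exact ENNReal.inv_mul_cancel (by exact_mod_cast NeZero.ne N) (ENNReal.natCast_ne_top N)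
    · exact fun m _ => (measurable_channelDensity hs hg m).ennreal_ofReal
    · exact Finset.measurable_sum _ fun m _ => (measurable_channelDensity hs hg m).ennreal_ofReal

theorem lintegral_channelLaw {ν : Measure O}
    (hν : ν = volume.withDensity fun v => ENNReal.ofReal (g v)) {F : Fin N × O → ℝ≥0∞}
    (hF : Measurable F) :
    ∫⁻ p, F p ∂channelLaw κ s ν =
      ∑ m, ENNReal.ofReal (N : ℝ)⁻¹ * ∫⁻ u, F (m, u) * ENNReal.ofReal (channelDensity κ s g m u) := by
  have : SFinite ν := by rw [hν]; infer_instance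
  have hmap : Measurable fun p : (Fin N × X) × O => (p.1.1, s p.1.2 + p.2) := by fun_prop
  have hFm : Measurable fun p : (Fin N × X) × O => F (p.1.1, s p.1.2 + p.2) := hF.comp hmap
  rw [channelLaw, lintegral_map hF hmap, lintegral_prod _ hFm.aemeasurable,
    lintegral_uniform_compProd κ hFm.lintegral_prod_right']
  refine Finset.sum_congr rfl fun m _ => ?_
  rw [← lintegral_noise_add hs hg m (F := fun u => F (m, u)) (hF.comp measurable_prodMk_left)]
  congr 1
  refine lintegral_congr fun x => ?_
  have hFx : Measurable fun v => F (m, s x + v) := hF.comp (by fun_prop)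
  rw [hν, lintegral_withDensity_eq_lintegral_mul _ hg.measurable.ennreal_ofReal hFx]
  exact lintegral_congr fun v => mul_comm _ _

theorem channelLaw_eq_withDensity {ν : Measure O}
    (hν : ν = volume.withDensity fun v => ENNReal.ofReal (g v)) :
    channelLaw κ s ν = (Measure.count.prod volume).withDensity
      fun p => ENNReal.ofReal (jointDensity κ s g p) := by
  refine Measure.ext_of_lintegral _ fun F hF => ?_
  have hm := (measurable_jointDensity (κ := κ) hs hg).ennreal_ofReal
  rw [lintegral_channelLaw hs hg hν hF, lintegral_withDensity_eq_lintegral_mul _ hm hF,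
    lintegral_count_prod (hm.mul hF)]
  refine Finset.sum_congr rfl fun m _ => ?_
  have hFm : Measurable fun u => F (m, u) * ENNReal.ofReal (channelDensity κ s g m u) :=
    (hF.comp measurable_prodMk_left).mul (measurable_channelDensity hs hg m).ennreal_ofReal
  rw [← lintegral_const_mul _ hFm]
  refine lintegral_congr fun u => ?_
  rw [Pi.mul_apply, jointDensity, ENNReal.ofReal_mul (by positivity), mul_comm (F (m, u)),
    mul_assoc]

omit hs hg [SFinite (volume : Measure O)] [(volume : Measure O).IsAddLeftInvariant]
  [MeasurableSub₂ O] in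
theorem isProbabilityMeasure_channelLaw (hs : Measurable s) (ν : Measure O)
    [IsProbabilityMeasure ν] : IsProbabilityMeasure (channelLaw κ s ν) :=
  Measure.isProbabilityMeasure_map (by fun_prop)

end Density

end Channel

/-! ### Leakage as a difference of entropies -/

section Leakage

variable {N : ℕ} [NeZero N] {X O : Type*} [MeasurableSpace X] [MeasureSpace O] [AddCommGroup O]
  [MeasurableSub₂ O] [MeasurableAdd₂ O] [SigmaFinite (volume : Measure O)]
  [(volume : Measure O).IsAddLeftInvariant]
  {κ : Kernel (Fin N) X} [IsMarkovKernel κ] {s : X → O} {g : O → ℝ}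

theorem channelLaw_map_fst (hs : Measurable s) (hg : IsNoiseDensity g) {ν : Measure O}
    (hν : ν = volume.withDensity fun v => ENNReal.ofReal (g v)) :
    (channelLaw κ s ν).map Prod.fst =
      Measure.count.withDensity fun _ => ENNReal.ofReal (N : ℝ)⁻¹ := by
  refine Measure.ext_of_lintegral _ fun F hF => ?_
  have hF1 : Measurable fun p : Fin N × O => F p.1 := hF.comp measurable_fst
  rw [lintegral_map hF measurable_fst, lintegral_channelLaw hs hg hν hF1,
    lintegral_withDensity_eq_lintegral_mul _ measurable_const hF, lintegral_fintype]
  refine Finset.sum_congr rfl fun m _ => ?_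
  simp only
  rw [lintegral_const_mul _ (measurable_channelDensity hs hg m).ennreal_ofReal,
    lintegral_channelDensity hs hg]
  simp

theorem channelLaw_map_snd (hs : Measurable s) (hg : IsNoiseDensity g) {ν : Measure O}
    (hν : ν = volume.withDensity fun v => ENNReal.ofReal (g v)) :
    (channelLaw κ s ν).map Prod.snd =
      volume.withDensity fun u => ENNReal.ofReal (meanDensity κ s g u) := by
  refine Measure.ext_of_lintegral _ fun F hF => ?_
  have hm := (isNoiseDensity_meanDensity (κ := κ) hs hg).measurable.ennreal_ofReal
  have hfm := fun m => (measurable_channelDensity (κ := κ) hs hg m).ennreal_ofReal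
  have hF2 : Measurable fun p : Fin N × O => F p.2 := hF.comp measurable_snd
  have hFf : ∀ m, Measurable fun u => F u * ENNReal.ofReal (channelDensity κ s g m u) :=
    fun m => hF.mul (hfm m)
  rw [lintegral_map hF measurable_snd, lintegral_channelLaw hs hg hν hF2,
    lintegral_withDensity_eq_lintegral_mul _ hm hF, ← Finset.mul_sum,
    ← lintegral_finsetSum _ fun m _ => hFf m, ← lintegral_const_mul _
      (Finset.measurable_fun_sum _ fun m _ => hFf m)]
  refine lintegral_congr fun u => ?_
  rw [Pi.mul_apply, meanDensity, ENNReal.ofReal_mul (by positivity),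
    ENNReal.ofReal_sum_of_nonneg fun m _ => (channelDensity_pos hs hg m u).le, ← Finset.mul_sum]
  ring

/-- The mutual information of the message and the output is the mean of the logarithm of the ratio
of the conditional to the unconditional output density. -/
theorem toReal_mutualInfo_channelLaw (hs : Measurable s) (hg : IsNoiseDensity g) {ν : Measure O}
    [IsProbabilityMeasure ν] (hν : ν = volume.withDensity fun v => ENNReal.ofReal (g v)) :
    (mutualInfo (channelLaw κ s ν)).toReal =
      ∫ p, (Real.log (channelDensity κ s g p.1 p.2) - Real.log (meanDensity κ s g p.2))
        ∂channelLaw κ s ν := by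
  have : IsProbabilityMeasure (channelLaw κ s ν) := isProbabilityMeasure_channelLaw hs ν
  have hfm := measurable_uncurry_channelDensity (κ := κ) hs hg
  have hmm := (isNoiseDensity_meanDensity (κ := κ) hs hg).measurable
  set μ := channelLaw κ s ν with hμ
  have : IsProbabilityMeasure (μ.map Prod.fst) :=
    Measure.isProbabilityMeasure_map measurable_fst.aemeasurable
  have : IsProbabilityMeasure (μ.map Prod.snd) :=
    Measure.isProbabilityMeasure_map measurable_snd.aemeasurable
  set ρ := (μ.map Prod.fst).prod (μ.map Prod.snd) with hρ
  have hpos := fun p : Fin N × O => channelDensity_pos (κ := κ) hs hg p.1 p.2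
  have hmpos := fun u : O => (isNoiseDensity_meanDensity (κ := κ) hs hg).pos u
  have hr : Measurable fun p : Fin N × O =>
      ENNReal.ofReal (channelDensity κ s g p.1 p.2 / meanDensity κ s g p.2) :=
    (hfm.div (hmm.comp measurable_snd)).ennreal_ofReal
  have hρd : ρ = (Measure.count.prod volume).withDensity
      fun p => ENNReal.ofReal (N : ℝ)⁻¹ * ENNReal.ofReal (meanDensity κ s g p.2) := by
    rw [hρ, hμ, channelLaw_map_fst hs hg hν, channelLaw_map_snd hs hg hν,
      prod_withDensity measurable_const hmm.ennreal_ofReal]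
  have hμρ : μ = ρ.withDensity fun p =>
      ENNReal.ofReal (channelDensity κ s g p.1 p.2 / meanDensity κ s g p.2) := by
    have hd : Measurable fun p : Fin N × O =>
        ENNReal.ofReal (N : ℝ)⁻¹ * ENNReal.ofReal (meanDensity κ s g p.2) :=
      (hmm.comp measurable_snd).ennreal_ofReal.const_mul _
    rw [hρd, ← withDensity_mul _ hd hr, hμ,
      channelLaw_eq_withDensity hs hg hν]
    congr 1
    funext p
    have := (hmpos p.2).ne'
    rw [Pi.mul_apply, ← ENNReal.ofReal_mul (by positivity),
      ← ENNReal.ofReal_mul (mul_nonneg (by positivity) (hmpos _).le), jointDensity]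
    congr 1
    field_simp
  have hac : μ ≪ ρ := by
    rw [hμρ]
    exact withDensity_absolutelyContinuous _ _
  have hrn : μ.rnDeriv ρ =ᵐ[μ] fun p =>
      ENNReal.ofReal (channelDensity κ s g p.1 p.2 / meanDensity κ s g p.2) := by
    have h := Measure.rnDeriv_withDensity ρ hr
    rw [← hμρ] at h
    exact hac.ae_le h
  rw [mutualInfo, InformationTheory.toReal_klDiv_of_measure_eq hac (by simp)]
  refine integral_congr_ae ?_
  filter_upwards [hrn] with p hp
  rw [llr_def]
  simp only [hp]
  rw [ENNReal.toReal_ofReal (div_pos (hpos p) (hmpos p.2)).le,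
    Real.log_div (hpos p).ne' (hmpos p.2).ne']

end Leakage

/-! ### Integrability of log-densities -/

theorem integrable_log_of_le {α : Type*} [MeasurableSpace α] {μ : Measure α} [IsFiniteMeasure μ]
    {f Q : α → ℝ} (hf : Measurable f) (hf0 : ∀ x, 0 < f x) (hf1 : ∀ x, f x ≤ 1)
    (hQ : Integrable Q μ) {C : ℝ} (h : ∀ x, -(C + Q x) ≤ Real.log (f x)) :
    Integrable (fun x => Real.log (f x)) μ := by
  refine ((integrable_const C).add hQ).mono (Real.measurable_log.comp hf).aestronglyMeasurable
    (ae_of_all _ fun x => ?_)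
  have h1 := Real.log_nonpos (hf0 x).le (hf1 x)
  rw [Real.norm_of_nonpos h1, Pi.add_apply]
  exact le_trans (by linarith [h x]) (le_abs_self _)

/-- The function `Q` controls the decay of the density `g` under translations: the logarithm of
`g (u - w)` is at least `-(Q u + Q w)` up to a constant. For the standard normal density, `Q` is
the square. -/
def LogDecay {O : Type*} [Sub O] (g Q : O → ℝ) : Prop :=
  ∃ C, ∀ u w, -(C + Q u + Q w) ≤ Real.log (g (u - w))

theorem logDecay_gaussianPDFReal : LogDecay (gaussianPDFReal 0 1) fun x => x ^ 2 := by
  refine ⟨1 / 2 * Real.log (2 * Real.pi * (1 : NNReal)), fun u w => ?_⟩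
  rw [log_gaussianPDFReal one_ne_zero, NNReal.coe_one]
  linarith [sq_nonneg (u + w)]

theorem LogDecay.pi {ι : Type*} [Fintype ι] {α : ι → Type*} [∀ i, Sub (α i)]
    {g Q : ∀ i, α i → ℝ} (hg : ∀ i v, 0 < g i v) (h : ∀ i, LogDecay (g i) (Q i)) :
    LogDecay (fun v : ∀ i, α i => ∏ i, g i (v i)) fun v => ∑ i, Q i (v i) := by
  choose C hC using h
  refine ⟨∑ i, C i, fun u w => ?_⟩
  rw [Real.log_prod fun i _ => (hg i _).ne', ← Finset.sum_add_distrib, ← Finset.sum_add_distrib,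
    ← Finset.sum_neg_distrib]
  exact Finset.sum_le_sum fun i _ => hC i _ _

theorem LogDecay.prod {α β : Type*} [Sub α] [Sub β] {f Q : α → ℝ} {g R : β → ℝ}
    (hf : ∀ v, 0 < f v) (hg : ∀ v, 0 < g v) (h : LogDecay f Q) (h' : LogDecay g R) :
    LogDecay (fun v : α × β => f v.1 * g v.2) fun v => Q v.1 + R v.2 := by
  obtain ⟨C, hC⟩ := h
  obtain ⟨D, hD⟩ := h'
  refine ⟨C + D, fun u w => ?_⟩
  rw [Real.log_mul (hf _).ne' (hg _).ne']
  have := hC u.1 w.1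
  have := hD u.2 w.2
  simp only [Prod.fst_sub, Prod.snd_sub]
  linarith

section Integrability

variable {N : ℕ} {X O : Type*} [MeasurableSpace X] [MeasureSpace O] [AddCommGroup O]
  [MeasurableSub₂ O] {κ : Kernel (Fin N) X} [IsMarkovKernel κ] {s : X → O} {g Q : O → ℝ}

/-- Averaging the decay bound over the input bounds the output densities from below. -/
theorem exists_le_log_channelDensity (hs : Measurable s) (hg : IsNoiseDensity g)
    (hQ0 : ∀ u, 0 ≤ Q u) (hQm : Measurable Q) (hd : LogDecay g Q) :
    ∃ C, ∀ m u, -(C + Q u) ≤ Real.log (channelDensity κ s g m u) := by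
  obtain ⟨C, hC⟩ := hd
  have hi : ∀ m, Integrable (fun x => Real.exp (-Q (s x))) (κ m) := fun m =>
    Integrable.of_bound (Real.measurable_exp.comp (hQm.comp hs).neg).aestronglyMeasurable 1
      (ae_of_all _ fun x => by
        rw [Real.norm_of_nonneg (Real.exp_pos _).le, Real.exp_le_one_iff]
        exact neg_nonpos.2 (hQ0 _))
  set a : Fin N → ℝ := fun m => ∫ x, Real.exp (-Q (s x)) ∂κ m with ha
  have ha0 : ∀ m, 0 < a m := fun m => integral_exp_pos (hi m)
  refine ⟨C + ∑ m, |Real.log (a m)|, fun m u => ?_⟩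
  have h1 : Real.exp (-(C + Q u)) * a m ≤ channelDensity κ s g m u := by
    rw [ha, ← integral_const_mul]
    refine integral_mono ((hi m).const_mul _) (integrable_noise_sub hs hg m u) fun x => ?_
    simp only
    rw [← Real.exp_add, ← Real.le_log_iff_exp_le (hg.pos _)]
    linarith [hC u (s x)]
  have h2 := Real.log_le_log (mul_pos (Real.exp_pos _) (ha0 m)) h1
  rw [Real.log_mul (Real.exp_pos _).ne' (ha0 m).ne', Real.log_exp] at h2
  have h3 : |Real.log (a m)| ≤ ∑ m, |Real.log (a m)| :=
    Finset.single_le_sum (f := fun m => |Real.log (a m)|) (fun _ _ => abs_nonneg _)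
      (Finset.mem_univ m)
  linarith [neg_abs_le (Real.log (a m))]

variable {μ : Measure (Fin N × O)} [IsFiniteMeasure μ]

theorem integrable_log_channelDensity (hs : Measurable s) (hg : IsNoiseDensity g)
    (hQ0 : ∀ u, 0 ≤ Q u) (hQm : Measurable Q) (hd : LogDecay g Q)
    (hQ : Integrable (fun p : Fin N × O => Q p.2) μ) :
    Integrable (fun p : Fin N × O => Real.log (channelDensity κ s g p.1 p.2)) μ := by
  obtain ⟨C, hC⟩ := exists_le_log_channelDensity (κ := κ) hs hg hQ0 hQm hd
  exact integrable_log_of_le (measurable_uncurry_channelDensity hs hg)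
    (fun p => channelDensity_pos hs hg _ _) (fun p => channelDensity_le_one hs hg _ _) hQ
    fun p => hC _ _

theorem integrable_log_meanDensity [NeZero N] [MeasurableAdd₂ O] [SFinite (volume : Measure O)]
    [(volume : Measure O).IsAddLeftInvariant] (hs : Measurable s) (hg : IsNoiseDensity g)
    (hQ0 : ∀ u, 0 ≤ Q u) (hQm : Measurable Q) (hd : LogDecay g Q)
    (hQ : Integrable (fun p : Fin N × O => Q p.2) μ) :
    Integrable (fun p : Fin N × O => Real.log (meanDensity κ s g p.2)) μ := by
  obtain ⟨C, hC⟩ := exists_le_log_channelDensity (κ := κ) hs hg hQ0 hQm hd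
  have hm := isNoiseDensity_meanDensity (κ := κ) hs hg
  have hN : (0 : ℝ) < N := Nat.cast_pos.2 (NeZero.pos N)
  refine integrable_log_of_le (hm.measurable.comp measurable_snd) (fun p => hm.pos _)
    (fun p => hm.le_one _) hQ (C := C) fun p => ?_
  rw [Real.le_log_iff_exp_le (hm.pos _), meanDensity, le_inv_mul_iff₀ hN]
  have : ∑ _m : Fin N, Real.exp (-(C + Q p.2)) ≤ ∑ m, channelDensity κ s g m p.2 :=
    Finset.sum_le_sum fun m _ => (Real.le_log_iff_exp_le (channelDensity_pos hs hg _ _)).1 (hC _ _)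
  simpa using this

end Integrability

/-! ### Sheared densities -/

section Shear

variable {Y Z : Type*} [MeasureSpace Y] [MeasureSpace Z] [SFinite (volume : Measure Z)]

/-- The joint density of a pair whose first component has density `p` and whose second component
deviates from a function of the first by an independent noise of density `r`. -/
theorem IsNoiseDensity.shear [AddGroup Z] [MeasurableSub₂ Z] [MeasurableAdd Z]
    [(volume : Measure Z).IsAddRightInvariant] {p : Y → ℝ} {r : Z → ℝ} (hp : IsNoiseDensity p)
    (hr : IsNoiseDensity r) {L : Y → Z} (hL : Measurable L) :
    IsNoiseDensity fun u : Y × Z => p u.1 * r (u.2 - L u.1) where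
  measurable := (hp.measurable.comp measurable_fst).mul
    (hr.measurable.comp (measurable_snd.sub (hL.comp measurable_fst)))
  pos u := mul_pos (hp.pos _) (hr.pos _)
  le_one u := mul_le_one₀ (hp.le_one _) (hr.pos _).le (hr.le_one _)
  lintegral_eq_one := by
    have hm : Measurable fun u : Y × Z => ENNReal.ofReal (p u.1 * r (u.2 - L u.1)) :=
      ((hp.measurable.comp measurable_fst).mul
        (hr.measurable.comp (measurable_snd.sub (hL.comp measurable_fst)))).ennreal_ofReal
    rw [Measure.volume_eq_prod, lintegral_prod _ hm.aemeasurable, ← hp.lintegral_eq_one]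
    refine lintegral_congr fun y => ?_
    simp_rw [ENNReal.ofReal_mul (hp.pos _).le]
    have hr' : Measurable fun z => ENNReal.ofReal (r (z - L y)) :=
      (hr.measurable.comp (measurable_id.sub_const _)).ennreal_ofReal
    rw [lintegral_const_mul _ hr',
      lintegral_sub_right_eq_self (fun z => ENNReal.ofReal (r z)), hr.lintegral_eq_one, mul_one]

theorem IsNoiseDensity.swap [SFinite (volume : Measure Y)] {f : Z × Y → ℝ} (hf : IsNoiseDensity f) :
    IsNoiseDensity fun u : Y × Z => f u.swap where
  measurable := hf.measurable.comp measurable_swap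
  pos u := hf.pos _
  le_one u := hf.le_one _
  lintegral_eq_one := by
    rw [← hf.lintegral_eq_one, Measure.volume_eq_prod, Measure.volume_eq_prod]
    exact lintegral_prod_swap (μ := (volume : Measure Z)) (ν := (volume : Measure Y))
      (fun u => ENNReal.ofReal (f u))

end Shear

/-! ### Entropy bounds for a channel output -/

section Entropy

variable {N : ℕ} [NeZero N] {X O : Type*} [MeasurableSpace X] [MeasureSpace O] [AddCommGroup O]
  [MeasurableSub₂ O] [MeasurableAdd₂ O] [SFinite (volume : Measure O)]
  [(volume : Measure O).IsAddLeftInvariant]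
  {κ : Kernel (Fin N) X} [IsMarkovKernel κ] {s : X → O} {g : O → ℝ} {ν : Measure O}
  [IsProbabilityMeasure ν]

/-- Gibbs' inequality for a joint law of message and output. -/
theorem integral_log_le_jointDensity (hs : Measurable s) (hg : IsNoiseDensity g)
    (hν : ν = volume.withDensity fun v => ENNReal.ofReal (g v))
    (hf : Integrable (fun p : Fin N × O => Real.log (channelDensity κ s g p.1 p.2))
      (channelLaw κ s ν))
    {q : Fin N × O → ℝ} (hq : Measurable q) (hq0 : ∀ p, 0 < q p)
    (hq1 : ∑ m, ∫⁻ u, ENNReal.ofReal (q (m, u)) ≤ 1)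
    (hqi : Integrable (fun p => Real.log (q p)) (channelLaw κ s ν)) :
    ∫ p, Real.log (q p) ∂channelLaw κ s ν ≤
      ∫ p, Real.log (channelDensity κ s g p.1 p.2) ∂channelLaw κ s ν - Real.log N := by
  have : IsProbabilityMeasure (channelLaw κ s ν) := isProbabilityMeasure_channelLaw hs ν
  have hN : (0 : ℝ) < N := Nat.cast_pos.2 (NeZero.pos N)
  have hlog : ∀ p : Fin N × O, Real.log (jointDensity κ s g p) =
      Real.log (channelDensity κ s g p.1 p.2) - Real.log N := fun p => by
    rw [jointDensity, Real.log_mul (inv_pos.2 hN).ne' (channelDensity_pos hs hg _ _).ne',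
      Real.log_inv]
    ring
  have key := integral_log_le_of_withDensity (channelLaw_eq_withDensity (κ := κ) hs hg hν)
    (measurable_jointDensity hs hg) hq (jointDensity_pos hs hg) hq0
    (by rwa [lintegral_count_prod hq.ennreal_ofReal])
    (by simp_rw [hlog]; exact hf.sub (integrable_const _)) hqi
  simp_rw [hlog] at key
  rw [integral_sub hf (integrable_const _)] at key
  simpa using key

/-- The conditional entropy of the output given the message is bounded by the cross entropy with
respect to any family of conditional densities. -/
theorem integral_log_conditional_le (hs : Measurable s) (hg : IsNoiseDensity g)
    (hν : ν = volume.withDensity fun v => ENNReal.ofReal (g v))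
    (hf : Integrable (fun p : Fin N × O => Real.log (channelDensity κ s g p.1 p.2))
      (channelLaw κ s ν))
    {d : Fin N → O → ℝ} (hd : ∀ m, IsNoiseDensity (d m))
    (hdi : Integrable (fun p : Fin N × O => Real.log (d p.1 p.2)) (channelLaw κ s ν)) :
    ∫ p, Real.log (d p.1 p.2) ∂channelLaw κ s ν ≤
      ∫ p, Real.log (channelDensity κ s g p.1 p.2) ∂channelLaw κ s ν := by
  have : IsProbabilityMeasure (channelLaw κ s ν) := isProbabilityMeasure_channelLaw hs ν
  have hN : (0 : ℝ) < N := Nat.cast_pos.2 (NeZero.pos N)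
  have hlog : ∀ p : Fin N × O, Real.log ((N : ℝ)⁻¹ * d p.1 p.2) =
      Real.log (d p.1 p.2) - Real.log N := fun p => by
    rw [Real.log_mul (inv_pos.2 hN).ne' ((hd _).pos _).ne', Real.log_inv]
    ring
  have hdm : Measurable fun p : Fin N × O => d p.1 p.2 :=
    measurable_from_prod_countable_right fun m => (hd m).measurable
  have key := integral_log_le_jointDensity (q := fun p => (N : ℝ)⁻¹ * d p.1 p.2) hs hg hν hf
    (hdm.const_mul _) (fun p => mul_pos (inv_pos.2 hN) ((hd _).pos _))
    (by
      simp_rw [ENNReal.ofReal_mul (inv_nonneg.2 hN.le)]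
      simp_rw [lintegral_const_mul _ (hd _).measurable.ennreal_ofReal, (hd _).lintegral_eq_one]
      rw [ENNReal.ofReal_inv_of_pos hN]
      simp only [Finset.sum_const, Finset.card_univ, Fintype.card_fin, nsmul_eq_mul, mul_one,
        ENNReal.ofReal_natCast]
      exact (ENNReal.mul_inv_cancel (by exact_mod_cast NeZero.ne N)
        (ENNReal.natCast_ne_top N)).le)
    (by simp_rw [hlog]; exact hdi.sub (integrable_const _))
  simp_rw [hlog] at key
  rw [integral_sub hdi (integrable_const _)] at key
  simpa using key

/-- A guess of the conditional law of the message given the decoded message `m'`: the decoded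
message and a uniformly distributed one, with probability one half each. -/
noncomputable def guess (m m' : Fin N) : ℝ :=
  2⁻¹ * (if m' = m then 1 else 0) + 2⁻¹ * (N : ℝ)⁻¹

theorem guess_pos (m m' : Fin N) : 0 < guess m m' := by
  have hN : (0 : ℝ) < N := Nat.cast_pos.2 (NeZero.pos N)
  rw [guess]
  split_ifs <;> positivity

theorem sum_guess (m' : Fin N) : ∑ m, guess m m' = 1 := by
  have hN : (N : ℝ) ≠ 0 := Nat.cast_ne_zero.2 (NeZero.ne N)
  simp only [guess, Finset.sum_add_distrib, ← Finset.mul_sum, Finset.sum_ite_eq, Finset.mem_univ,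
    if_true, Finset.sum_const, Finset.card_univ, Fintype.card_fin, nsmul_eq_mul]
  field_simp
  norm_num

theorem neg_le_log_guess (m m' : Fin N) :
    -(Real.log 2 + if m' ≠ m then Real.log N else 0) ≤ Real.log (guess m m') := by
  have hN : (0 : ℝ) < N := Nat.cast_pos.2 (NeZero.pos N)
  by_cases h : m' = m
  · rw [if_neg (not_not.2 h), add_zero, ← Real.log_inv]
    refine Real.log_le_log (by norm_num) ?_
    rw [guess, if_pos h, mul_one]
    exact le_add_of_nonneg_right (by positivity)
  · rw [if_pos h, ← Real.log_mul two_ne_zero hN.ne', ← Real.log_inv, guess, if_neg h, mul_inv,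
      mul_zero, zero_add]

theorem guess_le_one (m m' : Fin N) : guess m m' ≤ 1 :=
  (Finset.single_le_sum (f := fun m => guess m m') (fun _ _ => (guess_pos _ _).le)
    (Finset.mem_univ m)).trans_eq (sum_guess m')

/-- Fano's inequality, combined with the bound of an entropy by a cross entropy: if the message can
be decoded from the output with small error probability, then the conditional entropy of the
output given the message falls short of its unconditional bound by almost the entropy `log N` of
the message. -/
theorem fano (hs : Measurable s) (hg : IsNoiseDensity g)
    (hν : ν = volume.withDensity fun v => ENNReal.ofReal (g v))
    (hf : Integrable (fun p : Fin N × O => Real.log (channelDensity κ s g p.1 p.2))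
      (channelLaw κ s ν))
    {d : O → ℝ} (hd : IsNoiseDensity d)
    (hdi : Integrable (fun p : Fin N × O => Real.log (d p.2)) (channelLaw κ s ν))
    {δ : O → Fin N} (hδ : Measurable δ) :
    ∫ p, -Real.log (channelDensity κ s g p.1 p.2) ∂channelLaw κ s ν +
        (1 - (channelLaw κ s ν {p | δ p.2 ≠ p.1}).toReal) * Real.log N ≤
      Real.log 2 + ∫ p, -Real.log (d p.2) ∂channelLaw κ s ν := by
  have : IsProbabilityMeasure (channelLaw κ s ν) := isProbabilityMeasure_channelLaw hs ν
  set μ := channelLaw κ s ν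
  have hwm : Measurable fun p : Fin N × O => guess p.1 (δ p.2) :=
    (measurable_of_countable fun q : Fin N × Fin N => guess q.1 q.2).comp
      (measurable_fst.prodMk (hδ.comp measurable_snd))
  have hset : MeasurableSet {p : Fin N × O | δ p.2 ≠ p.1} :=
    (measurableSet_eq_fun (hδ.comp measurable_snd) measurable_fst).compl
  have hlog : ∀ p : Fin N × O, Real.log (guess p.1 (δ p.2) * d p.2) =
      Real.log (guess p.1 (δ p.2)) + Real.log (d p.2) := fun p =>
    Real.log_mul (guess_pos _ _).ne' (hd.pos _).ne'
  have herr : Integrable (fun p : Fin N × O => if δ p.2 ≠ p.1 then Real.log N else 0) μ :=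
    ((integrable_const (Real.log N)).indicator hset).congr
      (ae_of_all _ fun p => by simp [Set.indicator_apply])
  have hwi : Integrable (fun p : Fin N × O => Real.log (guess p.1 (δ p.2))) μ :=
    integrable_log_of_le hwm (fun p => guess_pos _ _) (fun p => guess_le_one _ _) herr
      (C := Real.log 2) fun p => neg_le_log_guess _ _
  have key := integral_log_le_jointDensity (q := fun p => guess p.1 (δ p.2) * d p.2) hs hg hν hf
    (hwm.mul (hd.measurable.comp measurable_snd)) (fun p => mul_pos (guess_pos _ _) (hd.pos _))
    (by
      have hm : ∀ m, Measurable fun u => ENNReal.ofReal (guess m (δ u) * d u) := fun m =>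
        ((hwm.comp measurable_prodMk_left).mul hd.measurable).ennreal_ofReal
      rw [← lintegral_finsetSum _ fun m _ => hm m, ← hd.lintegral_eq_one]
      refine lintegral_mono fun u => ?_
      rw [← ENNReal.ofReal_sum_of_nonneg fun m _ => (mul_pos (guess_pos _ _) (hd.pos _)).le,
        ← Finset.sum_mul, sum_guess, one_mul])
    (by simp_rw [hlog]; exact hwi.add hdi)
  simp_rw [hlog] at key
  rw [integral_add hwi hdi] at key
  have hw : -(Real.log 2 + (μ {p | δ p.2 ≠ p.1}).toReal * Real.log N) ≤
      ∫ p, Real.log (guess p.1 (δ p.2)) ∂μ := by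
    have h1 := integral_mono ((integrable_const (Real.log 2)).add herr).neg hwi
      fun p => neg_le_log_guess p.1 (δ p.2)
    refine le_trans (le_of_eq ?_) h1
    have h2 : ∫ p : Fin N × O, (if δ p.2 ≠ p.1 then Real.log N else 0) ∂μ =
        (μ {p | δ p.2 ≠ p.1}).toReal * Real.log N := by
      have := integral_indicator_const (μ := μ) (Real.log N) hset
      simpa [Set.indicator, Measure.real] using this
    rw [← h2]
    simp only [Pi.neg_apply, Pi.add_apply]
    rw [integral_neg, integral_add (integrable_const _) herr]
    simp
  rw [integral_neg, integral_neg]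
  linarith

end Entropy

/-! ### Gaussian noise -/

section Gaussian

variable {n : ℕ}

/-- The density of a vector of `n` independent centred normal variables of variance `V`. -/
noncomputable def gaussianDensity (V : NNReal) (v : Fin n → ℝ) : ℝ :=
  ∏ t, gaussianPDFReal 0 V (v t)

theorem isNoiseDensity_gaussianDensity {V : NNReal} (hV : 1 ≤ V) :
    IsNoiseDensity (gaussianDensity V : (Fin n → ℝ) → ℝ) :=
  IsNoiseDensity.pi fun _ => isNoiseDensity_gaussianPDFReal hV

theorem log_gaussianDensity {V : NNReal} (hV : V ≠ 0) (v : Fin n → ℝ) :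
    Real.log (gaussianDensity V v) =
      -(n * (1 / 2 * Real.log (2 * Real.pi * V)) + (∑ t, v t ^ 2) / (2 * V)) := by
  rw [gaussianDensity, Real.log_prod fun t _ => (gaussianPDFReal_pos _ _ _ hV).ne']
  simp_rw [log_gaussianPDFReal hV]
  rw [Finset.sum_neg_distrib, Finset.sum_add_distrib, Finset.sum_div]
  simp

theorem logDecay_gaussianDensity :
    LogDecay (gaussianDensity 1 : (Fin n → ℝ) → ℝ) fun v => ∑ t, v t ^ 2 :=
  LogDecay.pi (g := fun _ => gaussianPDFReal 0 1) (Q := fun _ x => x ^ 2)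
    (fun _ _ => gaussianPDFReal_pos _ _ _ one_ne_zero) fun _ => logDecay_gaussianPDFReal

theorem pi_gaussianReal_eq_withDensity :
    (Measure.pi fun _ : Fin n => gaussianReal 0 1) =
      volume.withDensity fun v => ENNReal.ofReal (gaussianDensity 1 v) := by
  rw [gaussianReal_of_var_ne_zero 0 one_ne_zero]
  exact pi_withDensity_ofReal _ _ (fun _ => integrable_gaussianPDFReal 0 1)
    fun _ _ => gaussianPDFReal_nonneg _ _ _

theorem integrable_sq_gaussianReal : Integrable (fun x => x ^ 2) (gaussianReal 0 1) :=
  (memLp_id_gaussianReal 2).integrable_sq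

theorem integral_sq_gaussianReal : ∫ x, x ^ 2 ∂gaussianReal 0 1 = 1 := by
  have h := variance_fun_id_gaussianReal (μ := 0) (v := 1)
  rw [variance_of_integral_eq_zero (by fun_prop) (by simp)] at h
  simpa using h

theorem integrable_sq_of_measurePreserving {Ω : Type*} [MeasurableSpace Ω] {P : Measure Ω}
    {X : Ω → ℝ} (hX : MeasurePreserving X P (gaussianReal 0 1)) :
    Integrable (fun ω => X ω ^ 2) P :=
  (hX.integrable_comp integrable_sq_gaussianReal.aestronglyMeasurable).2 integrable_sq_gaussianReal

theorem integral_sq_of_measurePreserving {Ω : Type*} [MeasurableSpace Ω] {P : Measure Ω}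
    {X : Ω → ℝ} (hX : MeasurePreserving X P (gaussianReal 0 1)) : ∫ ω, X ω ^ 2 ∂P = 1 := by
  rw [← integral_sq_gaussianReal, ← hX.map_eq, integral_map hX.measurable.aemeasurable]
  rw [hX.map_eq]
  exact integrable_sq_gaussianReal.aestronglyMeasurable

end Gaussian

/-! ### One terminal -/

theorem channelLaw_map {N : ℕ} [NeZero N] {X O O' : Type*} [MeasurableSpace X]
    [MeasureSpace O] [AddCommGroup O] [MeasurableAdd₂ O] [MeasureSpace O'] [AddCommGroup O']
    [MeasurableAdd₂ O'] {κ : Kernel (Fin N) X} [IsMarkovKernel κ] {s : X → O} (hs : Measurable s)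
    {ν : Measure O} [IsProbabilityMeasure ν] (π : O →+ O') (hπ : Measurable π) :
    (channelLaw κ s ν).map (fun p => (p.1, π p.2)) =
      channelLaw κ (fun x => π (s x)) (ν.map π) := by
  have h := Measure.map_prod_map ((PMF.uniformOfFintype (Fin N)).toMeasure ⊗ₘ κ) ν measurable_id hπ
  rw [Measure.map_id] at h
  rw [channelLaw, channelLaw, h, Measure.map_map (by fun_prop) (by fun_prop),
    Measure.map_map (by fun_prop) (by fun_prop)]
  congr 1
  funext p
  simp

/-- The noiseless output of a terminal with channel vector `a`. -/
noncomputable def signal {M n : ℕ} (a : EuclideanSpace ℝ (Fin M))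
    (x : Fin n → EuclideanSpace ℝ (Fin M)) : Fin n → ℝ :=
  fun t => inner ℝ a (x t)

@[fun_prop]
theorem measurable_signal {M n : ℕ} (a : EuclideanSpace ℝ (Fin M)) :
    Measurable (signal (n := n) a) := by
  unfold signal
  fun_prop

namespace Code

variable {M J₁ n : ℕ} (c : Code M J₁ n) (a : EuclideanSpace ℝ (Fin M))

theorem outputLaw_eq_channelLaw :
    c.outputLaw a = channelLaw c.enc (signal a) (Measure.pi fun _ => gaussianReal 0 1) :=
  rfl

instance : IsProbabilityMeasure (c.outputLaw a) :=
  isProbabilityMeasure_channelLaw (measurable_signal a) _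

instance : IsProbabilityMeasure c.inputLaw := by
  unfold inputLaw
  infer_instance

variable {c} in
theorem PowerConstraint.integrable_sum_sq {P : ℝ} (hP : c.PowerConstraint P) :
    Integrable (fun p => ∑ t, ‖p.2 t‖ ^ 2) c.inputLaw ∧
      (0 ≤ P → ∫ p, ∑ t, ‖p.2 t‖ ^ 2 ∂c.inputLaw ≤ n * P) := by
  have hm : Measurable fun p : Fin c.size × (Fin n → EuclideanSpace ℝ (Fin M)) =>
      ∑ t, ‖p.2 t‖ ^ 2 := by fun_prop
  have h0 : ∀ p : Fin c.size × (Fin n → EuclideanSpace ℝ (Fin M)), 0 ≤ ∑ t, ‖p.2 t‖ ^ 2 :=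
    fun p => Finset.sum_nonneg fun t _ => sq_nonneg _
  have hle : ∫⁻ p, ENNReal.ofReal (∑ t, ‖p.2 t‖ ^ 2) ∂c.inputLaw ≤ n * ENNReal.ofReal P := by
    refine le_trans (le_of_eq ?_) hP
    rw [← lintegral_finsetSum _ fun t _ => by fun_prop]
    refine lintegral_congr fun p => ?_
    rw [ENNReal.ofReal_sum_of_nonneg fun t _ => sq_nonneg _]
    refine Finset.sum_congr rfl fun t _ => ?_
    rw [ENNReal.ofReal_pow (norm_nonneg _), ofReal_norm]
  have hi : Integrable (fun p => ∑ t, ‖p.2 t‖ ^ 2) c.inputLaw := by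
    refine ⟨hm.aestronglyMeasurable, ?_⟩
    rw [hasFiniteIntegral_iff_ofReal (ae_of_all _ h0)]
    exact hle.trans_lt (ENNReal.mul_lt_top (ENNReal.natCast_lt_top n) ENNReal.ofReal_lt_top)
  refine ⟨hi, fun hP0 => ?_⟩
  rw [integral_eq_lintegral_of_nonneg_ae (ae_of_all _ h0) hm.aestronglyMeasurable]
  refine ENNReal.toReal_le_of_le_ofReal (by positivity) (hle.trans_eq ?_)
  rw [ENNReal.ofReal_mul (by positivity), ENNReal.ofReal_natCast]

variable {c} in
theorem PowerConstraint.integrable_output_sq {P : ℝ} (hP : c.PowerConstraint P) :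
    Integrable (fun p => ∑ t, p.2 t ^ 2) (c.outputLaw a) ∧
      (0 ≤ P → ∫ p, ∑ t, p.2 t ^ 2 ∂c.outputLaw a ≤ n * (2 * (‖a‖ ^ 2 * P + 1))) := by
  have hmap : Measurable fun p : (Fin c.size × (Fin n → EuclideanSpace ℝ (Fin M))) × (Fin n → ℝ) =>
      (p.1.1, fun t => inner ℝ a (p.1.2 t) + p.2 t) := by fun_prop
  have hm : Measurable fun p : Fin c.size × (Fin n → ℝ) => ∑ t, p.2 t ^ 2 := by fun_prop
  obtain ⟨hx, hxP⟩ := hP.integrable_sum_sq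
  set γ : Measure (Fin n → ℝ) := Measure.pi fun _ => gaussianReal 0 1 with hγ
  have hev : ∀ t, MeasurePreserving (fun v : Fin n → ℝ => v t) γ (gaussianReal 0 1) :=
    fun t => measurePreserving_eval _ t
  have hv : Integrable (fun v : Fin n → ℝ => ∑ t, v t ^ 2) γ :=
    integrable_finsetSum _ fun t _ => integrable_sq_of_measurePreserving (hev t)
  have hvn : ∫ v : Fin n → ℝ, ∑ t, v t ^ 2 ∂γ = n := by
    rw [integral_finsetSum _ fun t _ => integrable_sq_of_measurePreserving (hev t)]
    simp [integral_sq_of_measurePreserving (hev _)]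
  have hi1 := (hx.comp_fst γ).const_mul (2 * ‖a‖ ^ 2)
  have hi2 := (hv.comp_snd c.inputLaw).const_mul 2
  have hle : ∀ p : (Fin c.size × (Fin n → EuclideanSpace ℝ (Fin M))) × (Fin n → ℝ),
      ∑ t, (inner ℝ a (p.1.2 t) + p.2 t) ^ 2 ≤
        2 * ‖a‖ ^ 2 * ∑ t, ‖p.1.2 t‖ ^ 2 + 2 * ∑ t, p.2 t ^ 2 := fun p => by
    rw [Finset.mul_sum, Finset.mul_sum, ← Finset.sum_add_distrib]
    refine Finset.sum_le_sum fun t _ => ?_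
    have h1 : (inner ℝ a (p.1.2 t)) ^ 2 ≤ ‖a‖ ^ 2 * ‖p.1.2 t‖ ^ 2 := by
      rw [← mul_pow, ← sq_abs]
      exact pow_le_pow_left₀ (abs_nonneg _) (abs_real_inner_le_norm _ _) 2
    nlinarith [sq_nonneg (inner ℝ a (p.1.2 t) - p.2 t)]
  have hi : Integrable (fun p : (Fin c.size × (Fin n → EuclideanSpace ℝ (Fin M))) × (Fin n → ℝ) =>
      ∑ t, (inner ℝ a (p.1.2 t) + p.2 t) ^ 2) (c.inputLaw.prod γ) := by
    refine (hi1.add hi2).mono (hm.comp hmap).aestronglyMeasurable (ae_of_all _ fun p => ?_)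
    rw [Real.norm_of_nonneg (Finset.sum_nonneg fun t _ => sq_nonneg _)]
    exact (hle p).trans (le_abs_self _)
  refine ⟨(integrable_map_measure hm.aestronglyMeasurable hmap.aemeasurable).2 hi, fun hP0 => ?_⟩
  rw [outputLaw, integral_map hmap.aemeasurable hm.aestronglyMeasurable]
  refine (integral_mono hi (hi1.add hi2) hle).trans ?_
  simp only [Pi.add_apply]
  rw [integral_add hi1 hi2, integral_const_mul, integral_const_mul,
    integral_fun_fst (fun q : Fin c.size × (Fin n → EuclideanSpace ℝ (Fin M)) =>
      ∑ t, ‖q.2 t‖ ^ 2), integral_fun_snd (fun v : Fin n → ℝ => ∑ t, v t ^ 2), hvn]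
  simp only [probReal_univ, one_smul]
  nlinarith [mul_le_mul_of_nonneg_left (hxP hP0) (sq_nonneg ‖a‖)]

/-- The density of the output at a terminal with channel vector `a` given the message. -/
noncomputable def outputDensity : Fin c.size → (Fin n → ℝ) → ℝ :=
  channelDensity c.enc (signal a) (gaussianDensity 1)

/-- The conditional differential entropy (in nats) given the message of the output at a terminal
with channel vector `a`. -/
noncomputable def condEntropy : ℝ :=
  ∫ p, -Real.log (c.outputDensity a p.1 p.2) ∂c.outputLaw a

/-- The differential entropy (in nats) of the output at a terminal with channel vector `a`. -/
noncomputable def outputEntropy : ℝ :=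
  ∫ p, -Real.log (meanDensity c.enc (signal a) (gaussianDensity 1) p.2) ∂c.outputLaw a

theorem isNoiseDensity_outputDensity (m : Fin c.size) : IsNoiseDensity (c.outputDensity a m) :=
  isNoiseDensity_channelDensity (measurable_signal a) (isNoiseDensity_gaussianDensity le_rfl) m

theorem isNoiseDensity_meanOutputDensity :
    IsNoiseDensity (meanDensity c.enc (signal a) (gaussianDensity 1 : (Fin n → ℝ) → ℝ)) :=
  isNoiseDensity_meanDensity (measurable_signal a) (isNoiseDensity_gaussianDensity le_rfl)

theorem condEntropy_nonneg : 0 ≤ c.condEntropy a :=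
  integral_nonneg fun _ => neg_nonneg.2 (Real.log_nonpos
    ((c.isNoiseDensity_outputDensity a _).pos _).le ((c.isNoiseDensity_outputDensity a _).le_one _))

variable {c} {P : ℝ} (hP : c.PowerConstraint P)
include hP

theorem PowerConstraint.integrable_log_outputDensity :
    Integrable (fun p => Real.log (c.outputDensity a p.1 p.2)) (c.outputLaw a) :=
  integrable_log_channelDensity (measurable_signal a) (isNoiseDensity_gaussianDensity le_rfl)
    (fun _ => Finset.sum_nonneg fun _ _ => sq_nonneg _) (by fun_prop) logDecay_gaussianDensity
    (hP.integrable_output_sq a).1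

theorem PowerConstraint.integrable_log_meanDensity :
    Integrable (fun p => Real.log (meanDensity c.enc (signal a) (gaussianDensity 1) p.2))
      (c.outputLaw a) :=
  CompoundWiretap.integrable_log_meanDensity (measurable_signal a)
    (isNoiseDensity_gaussianDensity le_rfl)
    (fun _ => Finset.sum_nonneg fun _ _ => sq_nonneg _) (by fun_prop) logDecay_gaussianDensity
    (hP.integrable_output_sq a).1

theorem PowerConstraint.toReal_leakage :
    (c.leakage a).toReal = c.outputEntropy a - c.condEntropy a := by
  have hi1 := hP.integrable_log_outputDensity a
  have hi2 := hP.integrable_log_meanDensity a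
  rw [leakage, outputLaw_eq_channelLaw, toReal_mutualInfo_channelLaw (measurable_signal a)
    (isNoiseDensity_gaussianDensity le_rfl) pi_gaussianReal_eq_withDensity, outputEntropy,
    condEntropy, integral_neg, integral_neg, neg_sub_neg, ← integral_sub hi1 hi2]
  rfl

/-- The power constraint bounds the output entropy by that of a normal law of variance `1 + P`, up
to a constant per channel use. If the message can be decoded, its entropy `log c.size` is part of
the output entropy, so that the conditional entropy given the message is smaller by that amount. -/
theorem PowerConstraint.condEntropy_add_le (hP0 : 0 ≤ P) (j : Fin J₁) :
    c.condEntropy a + (1 - (c.errorProb a j).toReal) * Real.log c.size ≤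
      Real.log 2 + n * (1 / 2 * Real.log (2 * Real.pi * (1 + P)) + (1 + ‖a‖ ^ 2)) := by
  obtain ⟨hi, hb⟩ := hP.integrable_output_sq a
  set V : NNReal := 1 + P.toNNReal with hVdef
  have hV : 1 ≤ V := le_self_add
  have hV0 : V ≠ 0 := (one_pos.trans_le hV).ne'
  have hVP : (V : ℝ) = 1 + P := by
    rw [hVdef, NNReal.coe_add, NNReal.coe_one, Real.coe_toNNReal _ hP0]
  have hlog : ∀ p : Fin c.size × (Fin n → ℝ), Real.log (gaussianDensity V p.2) =
      -(n * (1 / 2 * Real.log (2 * Real.pi * (1 + P))) + (∑ t, p.2 t ^ 2) / (2 * (1 + P))) :=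
    fun p => by rw [log_gaussianDensity hV0, hVP]
  have hdi : Integrable (fun p : Fin c.size × (Fin n → ℝ) => Real.log (gaussianDensity V p.2))
      (c.outputLaw a) := by
    simp_rw [hlog]
    exact ((integrable_const _).add (hi.div_const _)).neg
  have key := fano (measurable_signal a) (isNoiseDensity_gaussianDensity le_rfl)
    pi_gaussianReal_eq_withDensity (hP.integrable_log_outputDensity a)
    (isNoiseDensity_gaussianDensity hV) hdi (c.measurable_dec j)
  refine le_trans key ?_
  refine add_le_add (le_refl (Real.log 2)) ?_
  rw [← outputLaw_eq_channelLaw]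
  simp_rw [hlog, neg_neg]
  rw [integral_add (integrable_const _) (hi.div_const _), integral_div, integral_const,
    probReal_univ, one_smul, mul_add (n : ℝ)]
  refine add_le_add le_rfl ?_
  rw [div_le_iff₀ (by positivity)]
  refine (hb hP0).trans ?_
  rw [mul_assoc]
  refine mul_le_mul_of_nonneg_left ?_ (Nat.cast_nonneg n)
  nlinarith [sq_nonneg ‖a‖]

end Code

/-! ### Joint outputs of two families of terminals -/

-- Stated for this product because the search for it exceeds the default `synthInstance.maxSize`.
instance {ι τ : Type*} [Fintype ι] [Fintype τ] {n : ℕ} :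
    (volume : Measure ((ι → Fin n → ℝ) × (τ → Fin n → ℝ))).IsAddLeftInvariant :=
  Measure.prod.instIsAddLeftInvariant

section Pair

variable {M n : ℕ} {ι τ : Type*} [Fintype ι] [Fintype τ]

/-- The noiseless outputs of two families of terminals. -/
noncomputable def pairSignal (h : ι → EuclideanSpace ℝ (Fin M)) (g : τ → EuclideanSpace ℝ (Fin M))
    (x : Fin n → EuclideanSpace ℝ (Fin M)) : (ι → Fin n → ℝ) × (τ → Fin n → ℝ) :=
  (fun j => signal (h j) x, fun k => signal (g k) x)

omit [Fintype ι] [Fintype τ] in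
theorem measurable_pairSignal (h : ι → EuclideanSpace ℝ (Fin M))
    (g : τ → EuclideanSpace ℝ (Fin M)) : Measurable (pairSignal (n := n) h g) := by
  unfold pairSignal
  fun_prop

variable (n ι τ) in
/-- Independent standard normal noise at all terminals of two families. -/
noncomputable def pairNoise : Measure ((ι → Fin n → ℝ) × (τ → Fin n → ℝ)) :=
  (Measure.pi fun _ => Measure.pi fun _ => gaussianReal 0 1).prod
    (Measure.pi fun _ => Measure.pi fun _ => gaussianReal 0 1)

instance : IsProbabilityMeasure (pairNoise n ι τ) := by
  unfold pairNoise
  infer_instance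

/-- The density of `pairNoise`. -/
noncomputable def pairNoiseDensity (v : (ι → Fin n → ℝ) × (τ → Fin n → ℝ)) : ℝ :=
  (∏ j, gaussianDensity 1 (v.1 j)) * ∏ k, gaussianDensity 1 (v.2 k)

theorem isNoiseDensity_prod_gaussianDensity :
    IsNoiseDensity fun v : ι → Fin n → ℝ => ∏ j, gaussianDensity 1 (v j) :=
  IsNoiseDensity.pi fun _ => isNoiseDensity_gaussianDensity le_rfl

theorem isNoiseDensity_pairNoiseDensity :
    IsNoiseDensity (pairNoiseDensity : (ι → Fin n → ℝ) × (τ → Fin n → ℝ) → ℝ) :=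
  isNoiseDensity_prod_gaussianDensity.prod isNoiseDensity_prod_gaussianDensity

theorem pi_pi_gaussianReal_eq_withDensity :
    (Measure.pi fun _ : ι => Measure.pi fun _ : Fin n => gaussianReal 0 1) =
      volume.withDensity fun v => ENNReal.ofReal (∏ j, gaussianDensity 1 (v j)) := by
  rw [pi_gaussianReal_eq_withDensity]
  exact pi_withDensity_ofReal _ _
    (fun _ => (isNoiseDensity_gaussianDensity le_rfl).integrable)
    fun _ v => ((isNoiseDensity_gaussianDensity le_rfl).pos v).le

theorem pairNoise_eq_withDensity :
    pairNoise n ι τ = volume.withDensity fun v => ENNReal.ofReal (pairNoiseDensity v) := by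
  rw [pairNoise, pi_pi_gaussianReal_eq_withDensity, pi_pi_gaussianReal_eq_withDensity,
    prod_withDensity isNoiseDensity_prod_gaussianDensity.measurable.ennreal_ofReal
      isNoiseDensity_prod_gaussianDensity.measurable.ennreal_ofReal, Measure.volume_eq_prod]
  congr 1
  funext v
  rw [pairNoiseDensity, ENNReal.ofReal_mul (isNoiseDensity_prod_gaussianDensity.pos v.1).le]

theorem logDecay_pairNoiseDensity :
    LogDecay (pairNoiseDensity : (ι → Fin n → ℝ) × (τ → Fin n → ℝ) → ℝ)
      fun u => ∑ j, ∑ t, u.1 j t ^ 2 + ∑ k, ∑ t, u.2 k t ^ 2 :=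
  LogDecay.prod (f := fun v : ι → Fin n → ℝ => ∏ j, gaussianDensity 1 (v j))
    (g := fun v : τ → Fin n → ℝ => ∏ j, gaussianDensity 1 (v j))
    (Q := fun v => ∑ j, ∑ t, v j t ^ 2) (R := fun v => ∑ k, ∑ t, v k t ^ 2)
    isNoiseDensity_prod_gaussianDensity.pos isNoiseDensity_prod_gaussianDensity.pos
    (LogDecay.pi (g := fun _ => gaussianDensity 1) (Q := fun _ v => ∑ t, v t ^ 2)
      (fun _ => (isNoiseDensity_gaussianDensity le_rfl).pos) fun _ => logDecay_gaussianDensity)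
    (LogDecay.pi (g := fun _ => gaussianDensity 1) (Q := fun _ v => ∑ t, v t ^ 2)
      (fun _ => (isNoiseDensity_gaussianDensity le_rfl).pos) fun _ => logDecay_gaussianDensity)

theorem measurePreserving_fst_apply (j : ι) :
    MeasurePreserving (fun v => v.1 j) (pairNoise n ι τ)
      (Measure.pi fun _ => gaussianReal 0 1) :=
  (measurePreserving_eval (fun _ : ι => Measure.pi fun _ : Fin n => gaussianReal 0 1) j).comp
    measurePreserving_fst

theorem measurePreserving_snd_apply (k : τ) :
    MeasurePreserving (fun v => v.2 k) (pairNoise n ι τ)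
      (Measure.pi fun _ => gaussianReal 0 1) :=
  (measurePreserving_eval (fun _ : τ => Measure.pi fun _ : Fin n => gaussianReal 0 1) k).comp
    measurePreserving_snd

/-! ### Predicting one family of outputs from the other -/

/-- The linear combinations, with coefficients `T`, of a family of sequences. -/
def mix (T : τ → ι → ℝ) (y : ι → Fin n → ℝ) : τ → Fin n → ℝ :=
  fun k t => ∑ j, T k j * y j t

omit [Fintype τ] in
@[fun_prop]
theorem measurable_mix (T : τ → ι → ℝ) : Measurable (mix (n := n) T) := by
  unfold mix
  fun_prop

/-- The squared error of the prediction of the second family of outputs by linear combinations of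
the first. -/
def residual (T : τ → ι → ℝ) (u : (ι → Fin n → ℝ) × (τ → Fin n → ℝ)) : ℝ :=
  ∑ k, ∑ t, (u.2 - mix T u.1) k t ^ 2

theorem measurable_residual (T : τ → ι → ℝ) : Measurable (residual (n := n) T) := by
  unfold residual
  simp only [Pi.sub_apply]
  fun_prop

theorem residual_pairSignal_add {h : ι → EuclideanSpace ℝ (Fin M)}
    {g : τ → EuclideanSpace ℝ (Fin M)} {T : τ → ι → ℝ} (hT : ∀ k, g k = ∑ j, T k j • h j)
    (x : Fin n → EuclideanSpace ℝ (Fin M)) (v : (ι → Fin n → ℝ) × (τ → Fin n → ℝ)) :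
    residual T (pairSignal h g x + v) = residual T v := by
  unfold residual
  refine Finset.sum_congr rfl fun k _ => Finset.sum_congr rfl fun t _ => ?_
  congr 1
  simp only [pairSignal, mix, signal, Prod.fst_add, Prod.snd_add, Pi.sub_apply, Pi.add_apply,
    hT k, sum_inner, real_inner_smul_left, mul_add, Finset.sum_add_distrib]
  ring

theorem residual_le (T : τ → ι → ℝ) (v : (ι → Fin n → ℝ) × (τ → Fin n → ℝ)) :
    residual T v ≤ ∑ k, ∑ t, 2 * (1 + ∑ j, T k j ^ 2) * (v.2 k t ^ 2 + ∑ j, v.1 j t ^ 2) := by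
  refine Finset.sum_le_sum fun k _ => Finset.sum_le_sum fun t _ => ?_
  have h1 := Finset.sum_mul_sq_le_sq_mul_sq Finset.univ (T k) fun j => v.1 j t
  have h2 : 0 ≤ ∑ j, T k j ^ 2 := Finset.sum_nonneg fun _ _ => sq_nonneg _
  have h3 : 0 ≤ ∑ j, v.1 j t ^ 2 := Finset.sum_nonneg fun _ _ => sq_nonneg _
  simp only [Pi.sub_apply, mix]
  nlinarith [sq_nonneg (v.2 k t + ∑ j, T k j * v.1 j t),
    mul_nonneg h2 (sq_nonneg (v.2 k t))]

theorem integrable_residual_pairNoise (T : τ → ι → ℝ) :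
    Integrable (residual T) (pairNoise n ι τ) ∧
      ∫ v, residual T v ∂pairNoise n ι τ ≤
        n * ∑ k, 2 * (1 + ∑ j, T k j ^ 2) * (1 + Fintype.card ι) := by
  have hev : ∀ t, MeasurePreserving (fun v : Fin n → ℝ => v t)
      (Measure.pi fun _ => gaussianReal 0 1) (gaussianReal 0 1) := fun t =>
    measurePreserving_eval _ t
  have hy : ∀ j t, MeasurePreserving (fun v => v.1 j t) (pairNoise n ι τ) (gaussianReal 0 1) :=
    fun j t => (hev t).comp (measurePreserving_fst_apply j)
  have hz : ∀ k t, MeasurePreserving (fun v => v.2 k t) (pairNoise n ι τ) (gaussianReal 0 1) :=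
    fun k t => (hev t).comp (measurePreserving_snd_apply k)
  have hyi := fun j t => integrable_sq_of_measurePreserving (hy j t)
  have hzi := fun k t => integrable_sq_of_measurePreserving (hz k t)
  have hsum : ∀ k t, Integrable (fun v : (ι → Fin n → ℝ) × (τ → Fin n → ℝ) =>
      v.2 k t ^ 2 + ∑ j, v.1 j t ^ 2) (pairNoise n ι τ) := fun k t =>
    (hzi k t).add (integrable_finsetSum _ fun j _ => hyi j t)
  have hb := integrable_finsetSum Finset.univ fun k _ => integrable_finsetSum Finset.univ
    fun t _ => (hsum k t).const_mul (2 * (1 + ∑ j, T k j ^ 2))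
  have hi : Integrable (residual T) (pairNoise n ι τ) := by
    refine hb.mono (measurable_residual T).aestronglyMeasurable (ae_of_all _ fun v => ?_)
    have h0 : 0 ≤ residual T v :=
      Finset.sum_nonneg fun _ _ => Finset.sum_nonneg fun _ _ => sq_nonneg _
    rw [Real.norm_of_nonneg h0]
    exact (residual_le T v).trans (le_abs_self _)
  refine ⟨hi, (integral_mono hi hb (residual_le T)).trans (le_of_eq ?_)⟩
  rw [integral_finsetSum _ fun k _ => integrable_finsetSum _ fun t _ => (hsum k t).const_mul _,
    Finset.mul_sum]
  refine Finset.sum_congr rfl fun k _ => ?_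
  rw [integral_finsetSum _ fun t _ => (hsum k t).const_mul _]
  simp_rw [integral_const_mul]
  have : ∀ t, ∫ v, (v.2 k t ^ 2 + ∑ j, v.1 j t ^ 2) ∂pairNoise n ι τ = 1 + Fintype.card ι := by
    intro t
    rw [integral_add (hzi k t) (integrable_finsetSum _ fun j _ => hyi j t),
      integral_finsetSum _ fun j _ => hyi j t, integral_sq_of_measurePreserving (hz k t)]
    simp [integral_sq_of_measurePreserving (hy _ t)]
  simp [this]

/-- The density under which the first family has independent components of densities `d j` and
the second family deviates from its linear prediction by standard normal noise. -/
noncomputable def shearDensity (d : ι → (Fin n → ℝ) → ℝ) (T : τ → ι → ℝ)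
    (u : (ι → Fin n → ℝ) × (τ → Fin n → ℝ)) : ℝ :=
  (∏ j, d j (u.1 j)) * ∏ k, gaussianDensity 1 ((u.2 - mix T u.1) k)

theorem isNoiseDensity_shearDensity {d : ι → (Fin n → ℝ) → ℝ} (hd : ∀ j, IsNoiseDensity (d j))
    (T : τ → ι → ℝ) : IsNoiseDensity (shearDensity d T) :=
  (IsNoiseDensity.pi hd).shear isNoiseDensity_prod_gaussianDensity (measurable_mix T)

theorem log_shearDensity {d : ι → (Fin n → ℝ) → ℝ} (hd : ∀ j, IsNoiseDensity (d j))
    (T : τ → ι → ℝ) (u : (ι → Fin n → ℝ) × (τ → Fin n → ℝ)) :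
    Real.log (shearDensity d T u) = ∑ j, Real.log (d j (u.1 j)) -
      (n * (Fintype.card τ * (1 / 2 * Real.log (2 * Real.pi))) + residual T u / 2) := by
  have hg := isNoiseDensity_gaussianDensity (n := n) (le_refl 1)
  rw [shearDensity, Real.log_mul (Finset.prod_pos fun j _ => (hd j).pos _).ne'
    (Finset.prod_pos fun k _ => hg.pos _).ne', Real.log_prod fun j _ => ((hd j).pos _).ne',
    Real.log_prod fun k _ => (hg.pos _).ne']
  simp_rw [log_gaussianDensity one_ne_zero]
  rw [Finset.sum_neg_distrib, Finset.sum_add_distrib, ← Finset.sum_div, residual]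
  simp
  ring

/-- A bound, per channel use, of the mean negative log-density of the error of the prediction of the
second family of outputs by the first. -/
noncomputable def mixCost (T : τ → ι → ℝ) : ℝ :=
  Fintype.card τ * (1 / 2 * Real.log (2 * Real.pi)) +
    ∑ k, (1 + ∑ j, T k j ^ 2) * (1 + Fintype.card ι)

namespace Code

variable {J₁ : ℕ} (c : Code M J₁ n) (h : ι → EuclideanSpace ℝ (Fin M))
  (g : τ → EuclideanSpace ℝ (Fin M))

/-- The joint law of the message and of the outputs at two families of terminals, with independent
noise at all terminals. -/
noncomputable def pairLaw : Measure (Fin c.size × ((ι → Fin n → ℝ) × (τ → Fin n → ℝ))) :=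
  channelLaw c.enc (pairSignal h g) (pairNoise n ι τ)

instance : IsProbabilityMeasure (c.pairLaw h g) :=
  isProbabilityMeasure_channelLaw (measurable_pairSignal h g) _

/-- The density of the outputs at two families of terminals given the message. -/
noncomputable def pairDensity : Fin c.size → (ι → Fin n → ℝ) × (τ → Fin n → ℝ) → ℝ :=
  channelDensity c.enc (pairSignal h g) pairNoiseDensity

/-- The conditional differential entropy (in nats) given the message of the outputs at two
families of terminals. -/
noncomputable def pairEntropy : ℝ :=
  ∫ p, -Real.log (c.pairDensity h g p.1 p.2) ∂c.pairLaw h g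

theorem pairLaw_map_swap :
    (c.pairLaw h g).map (fun p => (p.1, p.2.swap)) = c.pairLaw g h := by
  have := channelLaw_map (κ := c.enc) (measurable_pairSignal h g) (ν := pairNoise n ι τ)
    ((AddMonoidHom.snd (ι → Fin n → ℝ) (τ → Fin n → ℝ)).prod
      (AddMonoidHom.fst (ι → Fin n → ℝ) (τ → Fin n → ℝ))) measurable_swap
  refine this.trans ?_
  rw [pairLaw]
  congr 1
  exact Measure.prod_swap

theorem pairLaw_map_fst (j : ι) :
    (c.pairLaw h g).map (fun p => (p.1, p.2.1 j)) = c.outputLaw (h j) := by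
  have := channelLaw_map (κ := c.enc) (measurable_pairSignal h g) (ν := pairNoise n ι τ)
    ((Pi.evalAddMonoidHom (fun _ : ι => Fin n → ℝ) j).comp
      (AddMonoidHom.fst (ι → Fin n → ℝ) (τ → Fin n → ℝ)))
    ((measurable_pi_apply j).comp measurable_fst)
  refine this.trans ?_
  rw [outputLaw_eq_channelLaw]
  congr 1
  exact (measurePreserving_fst_apply j).map_eq

theorem measurePreserving_swap_pairLaw :
    MeasurePreserving (fun p => (p.1, p.2.swap)) (c.pairLaw h g) (c.pairLaw g h) :=
  ⟨by fun_prop, c.pairLaw_map_swap h g⟩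

theorem measurePreserving_fst_pairLaw (j : ι) :
    MeasurePreserving (fun p => (p.1, p.2.1 j)) (c.pairLaw h g) (c.outputLaw (h j)) :=
  ⟨by fun_prop, c.pairLaw_map_fst h g j⟩

theorem measurePreserving_snd_pairLaw (k : τ) :
    MeasurePreserving (fun p => (p.1, p.2.2 k)) (c.pairLaw h g) (c.outputLaw (g k)) :=
  (c.measurePreserving_fst_pairLaw g h k).comp (c.measurePreserving_swap_pairLaw h g)

variable {h g} in
theorem integrable_residual_pairLaw {T : τ → ι → ℝ} (hT : ∀ k, g k = ∑ j, T k j • h j) :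
    Integrable (fun p => residual T p.2) (c.pairLaw h g) ∧
      ∫ p, residual T p.2 ∂c.pairLaw h g ≤
        n * ∑ k, 2 * (1 + ∑ j, T k j ^ 2) * (1 + Fintype.card ι) := by
  have hm : Measurable fun p : Fin c.size × ((ι → Fin n → ℝ) × (τ → Fin n → ℝ)) =>
      residual T p.2 := (measurable_residual T).comp measurable_snd
  have hs := measurable_pairSignal (n := n) h g
  have hmap : Measurable fun p : (Fin c.size × (Fin n → EuclideanSpace ℝ (Fin M))) ×
      ((ι → Fin n → ℝ) × (τ → Fin n → ℝ)) => (p.1.1, pairSignal h g p.1.2 + p.2) := by fun_prop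
  obtain ⟨hi, hb⟩ := integrable_residual_pairNoise (n := n) T
  rw [pairLaw, channelLaw]
  constructor
  · rw [integrable_map_measure hm.aestronglyMeasurable hmap.aemeasurable]
    simp only [Function.comp_def, residual_pairSignal_add hT]
    exact hi.comp_snd _
  · rw [integral_map hmap.aemeasurable hm.aestronglyMeasurable]
    simp only [residual_pairSignal_add hT]
    rw [integral_fun_snd (residual T)]
    simpa using hb

variable {h g} in
/-- The cross entropy of the joint outputs with respect to a sheared density. -/
theorem integral_neg_log_shearDensity_le {T : τ → ι → ℝ} (hT : ∀ k, g k = ∑ j, T k j • h j)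
    {d : Fin c.size → ι → (Fin n → ℝ) → ℝ} (hd : ∀ m j, IsNoiseDensity (d m j))
    (hdi : ∀ j, Integrable (fun p => Real.log (d p.1 j p.2)) (c.outputLaw (h j))) :
    Integrable (fun p => Real.log (shearDensity (d p.1) T p.2)) (c.pairLaw h g) ∧
      ∫ p, -Real.log (shearDensity (d p.1) T p.2) ∂c.pairLaw h g ≤
        ∑ j, ∫ p, -Real.log (d p.1 j p.2) ∂c.outputLaw (h j) + n * mixCost T := by
  have hmp := c.measurePreserving_fst_pairLaw h g
  have hj : ∀ j, Integrable (fun p => Real.log (d p.1 j (p.2.1 j))) (c.pairLaw h g) := fun j =>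
    (hmp j).integrable_comp_of_integrable (hdi j)
  have hsum := integrable_finsetSum Finset.univ fun j _ => hj j
  obtain ⟨hr, hrb⟩ := c.integrable_residual_pairLaw hT
  have hc : Integrable (fun p => n * (Fintype.card τ * (1 / 2 * Real.log (2 * Real.pi))) +
      residual T p.2 / 2) (c.pairLaw h g) := (integrable_const _).add (hr.div_const 2)
  simp_rw [log_shearDensity (hd _)]
  refine ⟨hsum.sub hc, ?_⟩
  rw [integral_neg, integral_sub hsum hc, integral_finsetSum _ fun j _ => hj j,
    integral_add (integrable_const _) (hr.div_const 2), integral_div, integral_const,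
    probReal_univ, one_smul]
  have he : ∀ j, ∫ p, Real.log (d p.1 j (p.2.1 j)) ∂c.pairLaw h g =
      ∫ p, Real.log (d p.1 j p.2) ∂c.outputLaw (h j) := fun j => by
    rw [← (hmp j).map_eq, integral_map (hmp j).measurable.aemeasurable]
    rw [(hmp j).map_eq]
    exact (hdi j).aestronglyMeasurable
  simp_rw [he, integral_neg, Finset.sum_neg_distrib]
  have h2 : ∑ k, 2 * (1 + ∑ j, T k j ^ 2) * (1 + (Fintype.card ι : ℝ)) =
      2 * ∑ k, (1 + ∑ j, T k j ^ 2) * (1 + (Fintype.card ι : ℝ)) := by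
    rw [Finset.mul_sum]
    exact Finset.sum_congr rfl fun k _ => by ring
  rw [h2] at hrb
  rw [mixCost]
  linarith

end Code

end Pair

/-! ### Entropy inequalities for a code -/

namespace Code

variable {M J₁ n : ℕ} {ι τ : Type*} [Fintype ι] [Fintype τ] {c : Code M J₁ n} {P : ℝ}
  (hP : c.PowerConstraint P) {h : ι → EuclideanSpace ℝ (Fin M)} {g : τ → EuclideanSpace ℝ (Fin M)}
include hP

variable (h g) in
theorem PowerConstraint.integrable_log_pairDensity :
    Integrable (fun p => Real.log (c.pairDensity h g p.1 p.2)) (c.pairLaw h g) := by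
  refine integrable_log_channelDensity (measurable_pairSignal h g) isNoiseDensity_pairNoiseDensity
    (fun u => add_nonneg (Finset.sum_nonneg fun _ _ => Finset.sum_nonneg fun _ _ => sq_nonneg _)
      (Finset.sum_nonneg fun _ _ => Finset.sum_nonneg fun _ _ => sq_nonneg _))
    (by fun_prop) logDecay_pairNoiseDensity ?_
  exact (integrable_finsetSum _ fun j _ =>
      (c.measurePreserving_fst_pairLaw h g j).integrable_comp_of_integrable
        (hP.integrable_output_sq (h j)).1).add
    (integrable_finsetSum _ fun k _ =>
      (c.measurePreserving_snd_pairLaw h g k).integrable_comp_of_integrable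
        (hP.integrable_output_sq (g k)).1)

/-- Subadditivity: given the message, the outputs at terminals from which all others can be
predicted linearly have together, up to a bounded amount per channel use, all the entropy. -/
theorem PowerConstraint.pairEntropy_le {T : τ → ι → ℝ} (hT : ∀ k, g k = ∑ j, T k j • h j) :
    c.pairEntropy h g ≤ ∑ j, c.condEntropy (h j) + n * mixCost T := by
  obtain ⟨hi, hle⟩ := c.integral_neg_log_shearDensity_le hT
    (d := fun m j => c.outputDensity (h j) m)
    (fun m j => c.isNoiseDensity_outputDensity (h j) m)
    fun j => hP.integrable_log_outputDensity (h j)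
  refine le_trans ?_ hle
  rw [pairEntropy, integral_neg, integral_neg]
  exact neg_le_neg (integral_log_conditional_le (measurable_pairSignal h g)
    isNoiseDensity_pairNoiseDensity pairNoise_eq_withDensity (hP.integrable_log_pairDensity h g)
    (fun m => isNoiseDensity_shearDensity
      (fun j => c.isNoiseDensity_outputDensity (h j) m) T) hi)

/-- The joint outputs, from which the message can be decoded, have unconditional entropy at most
the sum of the entropies at the terminals from which all others can be predicted linearly. -/
theorem PowerConstraint.pairEntropy_add_le {T : ι → τ → ℝ} (hT : ∀ j, h j = ∑ k, T j k • g k)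
    (j : ι) (i : Fin J₁) :
    c.pairEntropy h g + (1 - (c.errorProb (h j) i).toReal) * Real.log c.size ≤
      Real.log 2 + (∑ k, c.outputEntropy (g k) + n * mixCost T) := by
  obtain ⟨hi, hle⟩ := c.integral_neg_log_shearDensity_le hT
    (d := fun _ k => meanDensity c.enc (signal (g k)) (gaussianDensity 1))
    (fun _ k => c.isNoiseDensity_meanOutputDensity (g k))
    fun k => hP.integrable_log_meanDensity (g k)
  have hd := isNoiseDensity_shearDensity (n := n)
    (fun k => c.isNoiseDensity_meanOutputDensity (g k)) T
  have hsw := c.measurePreserving_swap_pairLaw h g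
  have hδ : Measurable fun u : (ι → Fin n → ℝ) × (τ → Fin n → ℝ) => c.dec i (u.1 j) :=
    (c.measurable_dec i).comp ((measurable_pi_apply j).comp measurable_fst)
  have key := fano (measurable_pairSignal h g) isNoiseDensity_pairNoiseDensity
    pairNoise_eq_withDensity (hP.integrable_log_pairDensity h g) hd.swap
    (hsw.integrable_comp_of_integrable hi) hδ
  have herr : c.pairLaw h g {p | c.dec i (p.2.1 j) ≠ p.1} = c.errorProb (h j) i := by
    have hset : MeasurableSet {p : Fin c.size × (Fin n → ℝ) | c.dec i p.2 ≠ p.1} :=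
      (measurableSet_eq_fun ((c.measurable_dec i).comp measurable_snd) measurable_fst).compl
    exact (c.measurePreserving_fst_pairLaw h g j).measure_preimage hset.nullMeasurableSet
  have hint : ∫ p, -Real.log (shearDensity (fun k => meanDensity c.enc (signal (g k))
      (gaussianDensity 1)) T p.2.swap) ∂c.pairLaw h g =
      ∫ p, -Real.log (shearDensity (fun k => meanDensity c.enc (signal (g k))
      (gaussianDensity 1)) T p.2) ∂c.pairLaw g h := by
    rw [← hsw.map_eq, integral_map hsw.measurable.aemeasurable]
    rw [hsw.map_eq]
    exact hi.neg.aestronglyMeasurable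
  rw [← herr]
  refine le_trans key (add_le_add (le_refl (Real.log 2)) ?_)
  exact (le_of_eq hint).trans hle

/-- Since the noise densities are bounded by `1`, observing more terminals only increases the
conditional entropy given the message. -/
theorem PowerConstraint.condEntropy_le_pairEntropy (k : τ) :
    c.condEntropy (g k) ≤ c.pairEntropy h g := by
  classical
  have hmp := c.measurePreserving_snd_pairLaw h g k
  have hi := hP.integrable_log_outputDensity (g k)
  have h1 : c.condEntropy (g k) =
      ∫ p, -Real.log (c.outputDensity (g k) p.1 (p.2.2 k)) ∂c.pairLaw h g := by
    rw [condEntropy, ← hmp.map_eq, integral_map hmp.measurable.aemeasurable]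
    rw [hmp.map_eq]
    exact hi.neg.aestronglyMeasurable
  rw [h1, pairEntropy]
  refine integral_mono (hmp.integrable_comp_of_integrable hi).neg
    (hP.integrable_log_pairDensity h g).neg fun p => neg_le_neg (Real.log_le_log
      (channelDensity_pos (measurable_pairSignal h g) isNoiseDensity_pairNoiseDensity _ _) ?_)
  have hg1 := isNoiseDensity_gaussianDensity (n := n) (le_refl 1)
  refine integral_mono
    (integrable_noise_sub (measurable_pairSignal h g) isNoiseDensity_pairNoiseDensity _ _)
    (integrable_noise_sub (measurable_signal (g k)) hg1 _ _) fun x => ?_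
  refine (mul_le_of_le_one_left (Finset.prod_nonneg fun _ _ => (hg1.pos _).le)
    (Finset.prod_le_one (fun _ _ => (hg1.pos _).le) fun _ _ => hg1.le_one _)).trans ?_
  rw [← Finset.mul_prod_erase _ _ (Finset.mem_univ k)]
  exact mul_le_of_le_one_right (hg1.pos _).le
    (Finset.prod_le_one (fun _ _ => (hg1.pos _).le) fun _ _ => hg1.le_one _)

end Code

/-! ### Rate bounds at fixed power -/

section Rate

variable {M J₁ J₂ : ℕ} {h : Fin J₁ → EuclideanSpace ℝ (Fin M)}
  {g : Fin J₂ → EuclideanSpace ℝ (Fin M)} {P R : ℝ}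

/-- Elimination of the joint conditional entropy `G` of the outputs at the terminals `h (e j)` and
`g (f k)`: decodability at the former bounds `G` from above, and secrecy at the latter, where the
output entropies are then at most `G` up to the leakage, bounds `(M - 1) G` from below. -/
theorem Code.PowerConstraint.log_size_le {n : ℕ} {c : Code M J₁ n} (hP : c.PowerConstraint P)
    (hP0 : 0 ≤ P) (hM : 0 < M) {e : Fin M → Fin J₁} {f : Fin M → Fin J₂} {T U : Fin M → Fin M → ℝ}
    (hT : ∀ k, g (f k) = ∑ j, T k j • h (e j)) (hU : ∀ j, h (e j) = ∑ k, U j k • g (f k))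
    (j₀ : Fin M) :
    (1 - (c.errorProb (h (e j₀)) (e j₀)).toReal) * Real.log c.size ≤
      Real.log 2 + ∑ k, (c.leakage (g (f k))).toReal + n * mixCost U +
        (M - 1) * (∑ j, (Real.log 2 +
          n * (1 / 2 * Real.log (2 * Real.pi * (1 + P)) + (1 + ‖h (e j)‖ ^ 2)) -
          (1 - (c.errorProb (h (e j)) (e j)).toReal) * Real.log c.size) + n * mixCost T) := by
  have h1 := hP.pairEntropy_le hT
  have h2 : ∑ j, c.condEntropy (h (e j)) ≤ ∑ j, (Real.log 2 +
      n * (1 / 2 * Real.log (2 * Real.pi * (1 + P)) + (1 + ‖h (e j)‖ ^ 2)) -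
      (1 - (c.errorProb (h (e j)) (e j)).toReal) * Real.log c.size) :=
    Finset.sum_le_sum fun j _ => by linarith [hP.condEntropy_add_le (h (e j)) hP0 (e j)]
  have h3 := hP.pairEntropy_add_le hU j₀ (e j₀)
  have h4 : ∑ k, c.outputEntropy (g (f k)) ≤
      M * c.pairEntropy (fun j => h (e j)) (fun k => g (f k)) +
        ∑ k, (c.leakage (g (f k))).toReal := by
    have : ∀ k ∈ Finset.univ, c.outputEntropy (g (f k)) ≤
        c.pairEntropy (fun j => h (e j)) (fun k => g (f k)) + (c.leakage (g (f k))).toReal :=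
      fun k _ => by
        have := hP.toReal_leakage (g (f k))
        have := hP.condEntropy_le_pairEntropy (h := fun j => h (e j)) (g := fun k => g (f k)) k
        linarith
    refine (Finset.sum_le_sum this).trans_eq ?_
    rw [Finset.sum_add_distrib]
    simp
  have hM1 : (0 : ℝ) ≤ M - 1 := sub_nonneg.2 (Nat.one_le_cast.2 hM)
  have h5 := mul_le_mul_of_nonneg_left (h1.trans (add_le_add_left h2 _)) hM1
  linarith

theorem tendsto_log_div_of_logb {a : ℕ → ℕ}
    (ha : Tendsto (fun n => Real.logb 2 (a n) / n) atTop (𝓝 R)) :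
    Tendsto (fun n => Real.log (a n) / n) atTop (𝓝 (R * Real.log 2)) := by
  refine (ha.mul_const (Real.log 2)).congr fun n => ?_
  have : Real.log 2 ≠ 0 := (Real.log_pos one_lt_two).ne'
  rw [Real.logb]
  field_simp

/-- Without any secrecy demand, the rate is at most the capacity, up to a constant. -/
theorem AchievableRate.mul_log_two_le (hR : AchievableRate h g P R) (hP0 : 0 ≤ P) (j : Fin J₁) :
    R * Real.log 2 ≤ 1 / 2 * Real.log (2 * Real.pi * (1 + P)) + (1 + ‖h j‖ ^ 2) := by
  obtain ⟨c, hsize, hP, herr, -⟩ := hR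
  have hr := tendsto_log_div_of_logb hsize
  have hε : Tendsto (fun n => ((c n).errorProb (h j) j).toReal) atTop (𝓝 0) := by
    simpa [Function.comp_def] using (ENNReal.tendsto_toReal ENNReal.zero_ne_top).comp (herr j)
  have hl : Tendsto (fun n : ℕ => (1 - ((c n).errorProb (h j) j).toReal) *
      (Real.log (c n).size / n)) atTop (𝓝 (R * Real.log 2)) := by
    simpa using (hε.const_sub 1).mul hr
  have hu : Tendsto (fun n : ℕ => Real.log 2 / n +
      (1 / 2 * Real.log (2 * Real.pi * (1 + P)) + (1 + ‖h j‖ ^ 2))) atTop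
      (𝓝 (1 / 2 * Real.log (2 * Real.pi * (1 + P)) + (1 + ‖h j‖ ^ 2))) := by
    simpa using (tendsto_const_div_atTop_nhds_zero_nat (Real.log 2)).add_const
      (1 / 2 * Real.log (2 * Real.pi * (1 + P)) + (1 + ‖h j‖ ^ 2))
  refine le_of_tendsto_of_tendsto hl hu ?_
  filter_upwards [eventually_gt_atTop 0] with n hn
  have hn' : (0 : ℝ) < n := Nat.cast_pos.2 hn
  have h1 := (hP n).condEntropy_add_le (h j) hP0 j
  have h2 := (c n).condEntropy_nonneg (h j)
  rw [← mul_div_assoc, div_add' _ _ _ hn'.ne', div_le_div_iff_of_pos_right hn']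
  linarith

/-- The secrecy rate bound, up to constants which do not depend on the power. -/
theorem AchievableRate.mul_log_two_le_of_span (hR : AchievableRate h g P R) (hP0 : 0 ≤ P)
    (hM : 0 < M) {e : Fin M → Fin J₁} {f : Fin M → Fin J₂} {T U : Fin M → Fin M → ℝ}
    (hT : ∀ k, g (f k) = ∑ j, T k j • h (e j)) (hU : ∀ j, h (e j) = ∑ k, U j k • g (f k)) :
    R * Real.log 2 ≤ mixCost U + (M - 1) * (∑ j, (1 / 2 * Real.log (2 * Real.pi * (1 + P)) +
      (1 + ‖h (e j)‖ ^ 2) - R * Real.log 2) + mixCost T) := by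
  obtain ⟨c, hsize, hP, herr, hleak⟩ := hR
  have hr := tendsto_log_div_of_logb hsize
  have hε : ∀ j, Tendsto (fun n => ((c n).errorProb (h j) j).toReal) atTop (𝓝 0) := fun j => by
    simpa [Function.comp_def] using (ENNReal.tendsto_toReal ENNReal.zero_ne_top).comp (herr j)
  have hk : ∀ k, Tendsto (fun n : ℕ => ((c n).leakage (g k)).toReal / n) atTop (𝓝 0) := fun k => by
    have := (ENNReal.tendsto_toReal ENNReal.zero_ne_top).comp (hleak k)
    simpa [Function.comp_def, ENNReal.toReal_div] using this
  have hl : ∀ j, Tendsto (fun n : ℕ => (1 - ((c n).errorProb (h (e j)) (e j)).toReal) *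
      (Real.log (c n).size / n)) atTop (𝓝 (R * Real.log 2)) := fun j => by
    simpa using ((hε (e j)).const_sub 1).mul hr
  have h2 := tendsto_const_div_atTop_nhds_zero_nat (Real.log 2)
  have hu : Tendsto (fun n : ℕ => Real.log 2 / n +
      ∑ k, ((c n).leakage (g (f k))).toReal / n + mixCost U +
        (M - 1) * (∑ j, (Real.log 2 / n +
          (1 / 2 * Real.log (2 * Real.pi * (1 + P)) + (1 + ‖h (e j)‖ ^ 2)) -
          (1 - ((c n).errorProb (h (e j)) (e j)).toReal) * (Real.log (c n).size / n)) +
          mixCost T)) atTop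
      (𝓝 (0 + ∑ _k : Fin M, 0 + mixCost U + (M - 1) * (∑ j, (0 +
        (1 / 2 * Real.log (2 * Real.pi * (1 + P)) + (1 + ‖h (e j)‖ ^ 2)) - R * Real.log 2) +
          mixCost T))) :=
    ((h2.add (tendsto_finsetSum _ fun k _ => hk (f k))).add_const _).add
      (((tendsto_finsetSum _ fun j _ => (h2.add_const _).sub (hl j)).add_const _).const_mul _)
  simp only [Finset.sum_const_zero, zero_add] at hu
  refine le_of_tendsto_of_tendsto (hl ⟨0, hM⟩) hu ?_
  filter_upwards [eventually_gt_atTop 0] with n hn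
  have hn' : (0 : ℝ) < n := Nat.cast_pos.2 hn
  have h1 := (hP n).log_size_le hP0 hM hT hU ⟨0, hM⟩
  rw [← mul_div_assoc, div_le_iff₀ hn']
  refine h1.trans_eq ?_
  have hs : ∀ j, (Real.log 2 / n +
      (1 / 2 * Real.log (2 * Real.pi * (1 + P)) + (1 + ‖h (e j)‖ ^ 2)) -
      (1 - ((c n).errorProb (h (e j)) (e j)).toReal) * (Real.log (c n).size / n)) =
      (Real.log 2 + n * (1 / 2 * Real.log (2 * Real.pi * (1 + P)) + (1 + ‖h (e j)‖ ^ 2)) -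
      (1 - ((c n).errorProb (h (e j)) (e j)).toReal) * Real.log (c n).size) / n := fun j => by
    field_simp
  simp_rw [hs]
  rw [← Finset.sum_div, ← Finset.sum_div]
  have hscale : ∀ a b u S t : ℝ, a + b + n * u + (M - 1) * (S + n * t) =
      (a / n + b / n + u + (M - 1) * (S / n + t)) * n := fun a b u S t => by field_simp
  exact hscale _ _ _ _ _

end Rate

/-! ### Degrees of freedom -/

/-- A bound of the rate by the logarithm of the power, with a constant offset, bounds the degrees
of freedom. -/
theorem mul_le_of_tendsto_div_logb {R : ℝ → ℝ} {d α β C : ℝ}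
    (hd : Tendsto (fun P => R P / (1 / 2 * Real.logb 2 P)) atTop (𝓝 d))
    (hR : ∀ P, 0 < P →
      β * (R P * Real.log 2) ≤ α * (1 / 2 * Real.log (2 * Real.pi * (1 + P))) + C)
    (hα : 0 ≤ α) : β * d ≤ α := by
  set D := α * (1 / 2 * Real.log (4 * Real.pi)) + C with hD
  have hu : Tendsto (fun P : ℝ => α + D / (1 / 2 * Real.log P)) atTop (𝓝 (α + 0)) :=
    ((Real.tendsto_log_atTop.const_mul_atTop (by norm_num)).const_div_atTop D).const_add α
  rw [add_zero] at hu
  refine le_of_tendsto_of_tendsto (hd.const_mul β) hu ?_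
  filter_upwards [eventually_gt_atTop 1] with P hP
  have hP0 : 0 < P := one_pos.trans hP
  have hlog : 0 < Real.log P := Real.log_pos hP
  have h2 : 0 < Real.log 2 := Real.log_pos one_lt_two
  have h1 : Real.log (2 * Real.pi * (1 + P)) ≤ Real.log (4 * Real.pi) + Real.log P := by
    rw [← Real.log_mul (by positivity) hP0.ne']
    exact Real.log_le_log (by positivity) (by nlinarith [Real.pi_pos])
  have h3 : β * (R P * Real.log 2) ≤ α * (1 / 2 * Real.log P) + D := by
    have := mul_le_mul_of_nonneg_left h1 hα
    linarith [hR P hP0]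
  rw [Real.logb]
  have h4 : β * (R P / (1 / 2 * (Real.log P / Real.log 2))) =
      β * (R P * Real.log 2) / (1 / 2 * Real.log P) := by field_simp
  rw [h4, add_div' _ _ _ (by positivity)]
  exact div_le_div_of_nonneg_right h3 (by positivity)

theorem AchievableDoF.le_one {M J₁ J₂ : ℕ} {h : Fin J₁ → EuclideanSpace ℝ (Fin M)}
    {g : Fin J₂ → EuclideanSpace ℝ (Fin M)} {d : ℝ} (hd : AchievableDoF h g d) (j : Fin J₁) :
    d ≤ 1 := by
  obtain ⟨R, hR, hlim⟩ := hd
  have := mul_le_of_tendsto_div_logb (α := 1) (β := 1) hlim (fun P hP => by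
    rw [one_mul, one_mul]
    exact (hR P hP).mul_log_two_le hP.le j) zero_le_one
  linarith

theorem AchievableDoF.le_of_span {M J₁ J₂ : ℕ} {h : Fin J₁ → EuclideanSpace ℝ (Fin M)}
    {g : Fin J₂ → EuclideanSpace ℝ (Fin M)} {d : ℝ} (hd : AchievableDoF h g d) (hM : 0 < M)
    {e : Fin M → Fin J₁} {f : Fin M → Fin J₂}
    (hT : ∀ v, ∃ t : Fin M → ℝ, v = ∑ j, t j • h (e j))
    (hU : ∀ v, ∃ t : Fin M → ℝ, v = ∑ k, t k • g (f k)) :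
    d ≤ 1 - 1 / ((M : ℝ) ^ 2 - M + 1) := by
  obtain ⟨R, hR, hlim⟩ := hd
  choose T hT using fun k => hT (g (f k))
  choose U hU using fun j => hU (h (e j))
  have hM1 : (1 : ℝ) ≤ M := Nat.one_le_cast.2 hM
  have hα : (0 : ℝ) ≤ M * (M - 1) := mul_nonneg (by positivity) (sub_nonneg.2 hM1)
  have key := mul_le_of_tendsto_div_logb (α := M * (M - 1)) (β := 1 + M * (M - 1))
    (C := mixCost U + (M - 1) * (∑ j, (1 + ‖h (e j)‖ ^ 2) + mixCost T)) hlim (fun P hP => by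
    have := (hR P hP).mul_log_two_le_of_span hP.le hM hT hU
    rw [Finset.sum_sub_distrib, Finset.sum_add_distrib, Finset.sum_const, Finset.sum_const,
      Finset.card_univ, Fintype.card_fin, nsmul_eq_mul, nsmul_eq_mul] at this
    linarith) hα
  have hpos : (0 : ℝ) < (M : ℝ) ^ 2 - M + 1 := by nlinarith
  rw [le_sub_iff_add_le, ← le_sub_iff_add_le', div_le_iff₀ hpos]
  linarith

/-- Distinct vectors of a set, any `M` of which are linearly independent, span the space. -/
theorem exists_eq_sum_smul {M : ℕ} {A : Set (EuclideanSpace ℝ (Fin M))}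
    (hA : ∀ S : Finset (EuclideanSpace ℝ (Fin M)), (S : Set (EuclideanSpace ℝ (Fin M))) ⊆ A →
      S.card ≤ M → LinearIndependent ℝ (fun v : S => (v : EuclideanSpace ℝ (Fin M))))
    {b : Fin M → EuclideanSpace ℝ (Fin M)} (hb : Function.Injective b) (hbA : ∀ j, b j ∈ A)
    (v : EuclideanSpace ℝ (Fin M)) : ∃ t : Fin M → ℝ, v = ∑ j, t j • b j := by
  classical
  have hli := hA (Finset.univ.image b) (by simpa [Set.range_subset_iff] using hbA)
    (Finset.card_image_le.trans_eq (by simp))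
  have hlb : LinearIndependent ℝ b :=
    hli.comp (fun j => ⟨b j, Finset.mem_image_of_mem _ (Finset.mem_univ j)⟩)
      fun i j hij => hb (congrArg Subtype.val hij)
  have htop := hlb.span_eq_top_of_card_eq_finrank' (by simp)
  obtain ⟨t, ht⟩ := (Submodule.mem_span_range_iff_exists_fun ℝ).1
    (htop ▸ Submodule.mem_top : v ∈ Submodule.span ℝ (Set.range b))
  exact ⟨t, ht.symm⟩

end CompoundWiretap

theorem theorem2 (M J₁ J₂ : ℕ) (hM : 0 < M) (hJ₁ : 0 < J₁)
    (h : Fin J₁ → EuclideanSpace ℝ (Fin M)) (g : Fin J₂ → EuclideanSpace ℝ (Fin M))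
    (h_inj : Function.Injective h) (g_inj : Function.Injective g)
    (h_indep : ∀ S : Finset (EuclideanSpace ℝ (Fin M)),
      (S : Set (EuclideanSpace ℝ (Fin M))) ⊆ Set.range h ∪ Set.range g → S.card ≤ M →
        LinearIndependent ℝ (fun v : S => (v : EuclideanSpace ℝ (Fin M)))) :
    CompoundWiretap.secrecyDoF h g ≤
      ((if min J₁ J₂ < M then 1 else 1 - 1 / ((M : ℝ) ^ 2 - M + 1) : ℝ) : EReal) := by
  refine iSup₂_le fun d (hd : CompoundWiretap.AchievableDoF h g d) => EReal.coe_le_coe_iff.2 ?_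
  split_ifs with hJ
  · exact hd.le_one ⟨0, hJ₁⟩
  · obtain ⟨hMJ₁, hMJ₂⟩ := le_min_iff.1 (not_lt.1 hJ)
    exact hd.le_of_span hM
      (CompoundWiretap.exists_eq_sum_smul h_indep (h_inj.comp (Fin.castLE_injective hMJ₁))
        fun j => Or.inl ⟨_, rfl⟩)
      (CompoundWiretap.exists_eq_sum_smul h_indep (g_inj.comp (Fin.castLE_injective hMJ₂))
        fun k => Or.inr ⟨_, rfl⟩)
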